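/- Theorem 1. Let $n$ be a positive integer and $a\in\mathbb R$. A periodic orbit of a planar system is the image of a nonconstant periodic solution, and a limit cycle is a periodic orbit having a neighbourhood that contains no other periodic orbit. A limit cycle $\gamma$ is called stable if solutions starting sufficiently close to $\gamma$ (on either side) exist for all $t\ge 0$, remain close to $\gamma$, and tend to $\gamma$ as $t\to+\infty$; it is called unstable if it is stable for the system with time reversed. (1) The generalized Rayleigh system $$\dot x=y,\qquad \dot y=-x+a(1-y^{2n})y$$ has exactly one limit cycle if $a\neq0$. The limit cycle is stable if $a>0$ and unstable if $a<0$. For $a=0$ the system is a linear center, i.e. the vector field is linear and the origin is a singular point with a neighbourhood $U$ such that $U\setminus\{0\}$ is filled with periodic orbits. (2) The Liénard form of this system, $$\dot x=y+a(x^{2n}-1)x,\qquad \dot y=-x,$$ obtained from it by the change of variables $(x,y,t)\to(y,x,-t)$, which reverses time, has exactly one limit cycle if $a\neq0$. The limit cycle is stable if $a<0$ and unstable if $a>0$. For $a=0$ the system is a linear center. -/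

import Mathlib

open Set Filter Topology

/-- `γ` is a periodic orbit of the planar vector field `X`: the image of a nonconstant periodic
solution, defined on all of `ℝ`, of the autonomous differential system `z' = X z`. -/
def IsPeriodicOrbit (X : ℝ × ℝ → ℝ × ℝ) (γ : Set (ℝ × ℝ)) : Prop :=
  ∃ φ : ℝ → ℝ × ℝ, IsIntegralCurve φ (fun _ => X) ∧
    (∃ τ : ℝ, 0 < τ ∧ Function.Periodic φ τ) ∧ (∃ s t : ℝ, φ s ≠ φ t) ∧ Set.range φ = γ

/-- A limit cycle is a periodic orbit that is isolated in the set of all periodic orbits: some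
neighbourhood of it contains no other periodic orbit. -/
def IsLimitCycle (X : ℝ × ℝ → ℝ × ℝ) (γ : Set (ℝ × ℝ)) : Prop :=
  IsPeriodicOrbit X γ ∧
    ∃ U : Set (ℝ × ℝ), IsOpen U ∧ γ ⊆ U ∧ ∀ γ' ⊆ U, IsPeriodicOrbit X γ' → γ' = γ

/-- `φ` is a solution of `z' = X z` on the time interval `[0, ∞)`. -/
def IsForwardSolution (X : ℝ × ℝ → ℝ × ℝ) (φ : ℝ → ℝ × ℝ) : Prop :=
  IsIntegralCurveOn φ (fun _ => X) (Set.Ici 0)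

/-- (Asymptotic orbital) stability of a closed orbit `γ`: solutions that start near `γ`, on
either side of it, exist for all positive times, remain near `γ`, and tend to `γ` as
`t → +∞`. -/
structure IsStableCycle (X : ℝ × ℝ → ℝ × ℝ) (γ : Set (ℝ × ℝ)) : Prop where
  stays_near : ∀ U : Set (ℝ × ℝ), IsOpen U → γ ⊆ U →
    ∃ V : Set (ℝ × ℝ), IsOpen V ∧ γ ⊆ V ∧
      ∀ φ : ℝ → ℝ × ℝ, IsForwardSolution X φ → φ 0 ∈ V → ∀ t : ℝ, 0 ≤ t → φ t ∈ U
  attracts : ∃ W : Set (ℝ × ℝ), IsOpen W ∧ γ ⊆ W ∧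
    (∀ p ∈ W, ∃ φ : ℝ → ℝ × ℝ, IsForwardSolution X φ ∧ φ 0 = p) ∧
    ∀ φ : ℝ → ℝ × ℝ, IsForwardSolution X φ → φ 0 ∈ W →
      Tendsto (fun t => Metric.infDist (φ t) γ) atTop (𝓝 0)

/-- A closed orbit is unstable (a repelling cycle, on both sides) if it is stable when time is
reversed: nearby solutions remain near it in the past and tend to it as `t → -∞`. -/
def IsUnstableCycle (X : ℝ × ℝ → ℝ × ℝ) (γ : Set (ℝ × ℝ)) : Prop :=
  IsStableCycle (fun z => -X z) γ

/-- `p` is a center of `X`: a singular point with a neighbourhood `U` such that `U \ {p}` is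
filled with periodic orbits. -/
def IsCenter (X : ℝ × ℝ → ℝ × ℝ) (p : ℝ × ℝ) : Prop :=
  X p = 0 ∧ ∃ U : Set (ℝ × ℝ), IsOpen U ∧ p ∈ U ∧
    ∀ q ∈ U \ {p}, ∃ γ ⊆ U \ {p}, IsPeriodicOrbit X γ ∧ q ∈ γ

/-- A linear center: a linear planar system having a center at the origin. -/
def IsLinearCenter (X : ℝ × ℝ → ℝ × ℝ) : Prop :=
  IsLinearMap ℝ X ∧ IsCenter X 0

/-- The generalized Rayleigh system `x' = y`, `y' = -x + a (1 - y ^ (2 n)) y`. -/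
def rayleigh (n : ℕ) (a : ℝ) (z : ℝ × ℝ) : ℝ × ℝ :=
  (z.2, -z.1 + a * (1 - z.2 ^ (2 * n)) * z.2)

/-- The Liénard form `x' = y + a (x ^ (2 n) - 1) x`, `y' = -x` of the generalized Rayleigh
system, obtained from it by the change of variables `(x, y, t) → (y, x, -t)`, which reverses
time. -/
def rayleighLienard (n : ℕ) (a : ℝ) (z : ℝ × ℝ) : ℝ × ℝ :=
  (z.2 + a * (z.1 ^ (2 * n) - 1) * z.1, -z.1)

/-! ### Ordinary differential equations on a half-line -/

/-! Everything reduces to the Liénard form with `a = -b < 0`, that is `x' = y - F x`, `y' = -x` with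
`F x = b (x ^ (2 n + 1) - x)`. Linear isometries and time reversal carry its single stable orbit to
the remaining cases.

The key is the logarithmic radius `ρ` as a function of the clockwise angle `s`. With `g = F x / x`,
one has `dρ/ds = -sin² s · g / (1 - sin s cos s · g)`. Where the denominator is positive this is
nonincreasing in `g`, and `g` is nondecreasing in the radius. Hence two solutions compared at equal
angles never move apart (`abs_radius_sub_antitoneOn`). If one of them stays in an annulus, the gap
tends to `0` (`tendsto_radius_sub`): a gap bounded below would keep losing a fixed multiple of `∫
sin ^ (2 n + 2)`, which diverges. This contraction gives uniqueness and stability, and also the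
continuity needed for existence.

The comparison needs positive rotation, `x² + y² - y F x > 0`. This condition is forward invariant
(`rotation_pos`), and every nonconstant periodic solution satisfies it because it must meet the
`y`-axis (`angularMomentum_pos_of_periodic`).

For existence, follow solutions from the positive to the negative `y`-axis (`exists_half_return`).
The exterior of the unit disc is forward invariant and a line `y = x - K` blocks escape, so the
half-return map preserves the radii in `[1, K]`. By the symmetry `z ↦ -z`, a fixed point closes up
to a periodic orbit. -/

theorem eqOn_Icc_of_isIntegralCurveOn {X : ℝ × ℝ → ℝ × ℝ} (hX : ContDiff ℝ 1 X)
    {φ ψ : ℝ → ℝ × ℝ} {T : ℝ} (hφ : IsIntegralCurveOn φ (fun _ => X) (Icc 0 T))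
    (hψ : IsIntegralCurveOn ψ (fun _ => X) (Icc 0 T)) (h0 : φ 0 = ψ 0) :
    EqOn φ ψ (Icc 0 T) := by
  -- Both trajectories are compact, so they lie in one ball, on which the `C¹` field is Lipschitz.
  have hc : IsCompact (φ '' Icc 0 T ∪ ψ '' Icc 0 T) :=
    (isCompact_Icc.image_of_continuousOn hφ.continuousOn).union
      (isCompact_Icc.image_of_continuousOn hψ.continuousOn)
  obtain ⟨R, hR⟩ := hc.isBounded.subset_closedBall 0
  obtain ⟨K, hK⟩ := hX.contDiffOn.exists_lipschitzOnWith one_ne_zero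
    (convex_closedBall (0 : ℝ × ℝ) R) (isCompact_closedBall _ _)
  have key : ∀ {χ : ℝ → ℝ × ℝ}, IsIntegralCurveOn χ (fun _ => X) (Icc 0 T) →
      ∀ t ∈ Ico 0 T, HasDerivWithinAt χ (X (χ t)) (Ici t) t := fun hχ t ht =>
    (hχ t ⟨ht.1, ht.2.le⟩).mono_of_mem_nhdsWithin
      (mem_of_superset (Icc_mem_nhdsGE ht.2) (Icc_subset_Icc_left ht.1))
  exact ODE_solution_unique_of_mem_Icc_right (v := fun _ => X)
    (s := fun _ => Metric.closedBall 0 R) (fun t _ => hK) hφ.continuousOn (key hφ)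
    (fun t ht => hR (Or.inl ⟨t, ⟨ht.1, ht.2.le⟩, rfl⟩)) hψ.continuousOn (key hψ)
    (fun t ht => hR (Or.inr ⟨t, ⟨ht.1, ht.2.le⟩, rfl⟩)) h0

theorem IsForwardSolution.eqOn {X : ℝ × ℝ → ℝ × ℝ} (hX : ContDiff ℝ 1 X) {φ ψ : ℝ → ℝ × ℝ}
    (hφ : IsForwardSolution X φ) (hψ : IsForwardSolution X ψ) (h0 : φ 0 = ψ 0) :
    EqOn φ ψ (Ici 0) := fun t ht =>
  eqOn_Icc_of_isIntegralCurveOn hX (T := t) (hφ.mono Icc_subset_Ici_self)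
    (hψ.mono Icc_subset_Ici_self) h0 ⟨ht, le_rfl⟩

/-- A `C¹` vector field has a solution on `[0, T]` as soon as the solutions of all the fields
obtained by slowing it down obey a common a priori bound. -/
theorem exists_isIntegralCurveOn_Icc {X : ℝ × ℝ → ℝ × ℝ} (hX : ContDiff ℝ 1 X) (p : ℝ × ℝ)
    {T R : ℝ} (hT : 0 ≤ T)
    (hR : ∀ (c : ℝ → ℝ) (φ : ℝ → ℝ × ℝ), (∀ t, c t ∈ Icc (0 : ℝ) 1) → φ 0 = p →
      (∀ t ∈ Icc 0 T, HasDerivWithinAt φ (c t • X (φ t)) (Icc 0 T) t) →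
      ∀ t ∈ Icc 0 T, ‖φ t‖ ≤ R) :
    ∃ φ : ℝ → ℝ × ℝ, φ 0 = p ∧ IsIntegralCurveOn φ (fun _ => X) (Icc 0 T) := by
  -- The field cut off by a bump function is bounded and globally Lipschitz, so Picard–Lindelöf
  -- covers all of `[0, T]` at once. Its solution runs along `X` slowed by `f (φ t)`; the a priori
  -- bound then keeps it where `f = 1`.
  let f : ContDiffBump (0 : ℝ × ℝ) :=
    ⟨max R 0 + 1, max R 0 + 2, by positivity, by linarith⟩
  have hv : ContDiff ℝ 1 (fun z => f z • X z) := f.contDiff.smul hX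
  have hs : HasCompactSupport (fun z => f z • X z) := f.hasCompactSupport.smul_right
  obtain ⟨K, hK⟩ := ContDiff.lipschitzWith_of_hasCompactSupport hs hv one_ne_zero
  obtain ⟨C, hC⟩ := hs.exists_bound_of_continuous hv.continuous
  have hC0 : 0 ≤ C := (norm_nonneg _).trans (hC 0)
  have hPL : IsPicardLindelof (fun _ : ℝ => fun z => f z • X z) (⟨0, le_rfl, hT⟩ : Icc (0 : ℝ) T)
      p (⟨C, hC0⟩ * ⟨T, hT⟩) 0 ⟨C, hC0⟩ K :=
    { lipschitzOnWith := fun t _ => hK.lipschitzOnWith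
      continuousOn := fun x _ => continuousOn_const
      norm_le := fun t _ x _ => hC x
      mul_max_le := by
        simp only [sub_zero, sub_self, max_eq_left hT, NNReal.coe_zero]
        exact (NNReal.coe_mul ⟨C, hC0⟩ ⟨T, hT⟩).ge }
  obtain ⟨φ, h0, hφ⟩ := hPL.exists_eq_forall_mem_Icc_hasDerivWithinAt₀
  have hb := hR (fun t => f (φ t)) φ (fun t => ⟨f.nonneg, f.le_one⟩) h0 hφ
  refine ⟨φ, h0, fun t ht => ?_⟩
  have h1 : f (φ t) = 1 := f.one_of_mem_closedBall <| by
    rw [mem_closedBall_zero_iff]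
    change ‖φ t‖ ≤ max R 0 + 1
    linarith [hb t ht, le_max_left R 0]
  have := hφ t ht
  rwa [h1, one_smul] at this

theorem exists_isForwardSolution {X : ℝ × ℝ → ℝ × ℝ} (hX : ContDiff ℝ 1 X) (p : ℝ × ℝ)
    (h : ∀ T : ℝ, 0 ≤ T → ∃ φ : ℝ → ℝ × ℝ, φ 0 = p ∧
      IsIntegralCurveOn φ (fun _ => X) (Icc 0 T)) :
    ∃ φ : ℝ → ℝ × ℝ, IsForwardSolution X φ ∧ φ 0 = p := by
  choose α hα0 hα using fun N : ℕ => h (N + 1) (by positivity)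
  have hagree : ∀ {t : ℝ} {M N : ℕ}, 0 ≤ t → t ≤ M + 1 → M ≤ N → α M t = α N t := by
    intro t M N h0 h1 hMN
    have : (M : ℝ) ≤ N := by exact_mod_cast hMN
    exact eqOn_Icc_of_isIntegralCurveOn hX (T := M + 1) (hα M)
      ((hα N).mono (Icc_subset_Icc_right (by linarith))) ((hα0 M).trans (hα0 N).symm) ⟨h0, h1⟩
  -- All pieces agree where they overlap, so near `t` the glued curve coincides with the single
  -- solution `α (⌊t⌋₊ + 1)`.
  refine ⟨fun t => α ⌊t⌋₊ t, fun t ht => ?_, by simpa using hα0 0⟩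
  have ht0 : (0 : ℝ) ≤ t := ht
  have hlt := Nat.lt_floor_add_one t
  have hmem : Icc (0 : ℝ) ((⌊t⌋₊ + 1 : ℕ) + 1) ∈ 𝓝[Ici 0] t := by
    rw [← Ici_inter_Iic]
    exact inter_mem self_mem_nhdsWithin
      (mem_nhdsWithin_of_mem_nhds (Iic_mem_nhds (by push_cast; linarith)))
  have h1 := (hα (⌊t⌋₊ + 1) t ⟨ht0, by push_cast; linarith⟩).mono_of_mem_nhdsWithin hmem
  have heq : ∀ s ∈ Ici (0 : ℝ), s < ⌊t⌋₊ + 1 + 1 → α ⌊s⌋₊ s = α (⌊t⌋₊ + 1) s := by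
    intro s hs hst
    refine hagree hs (Nat.lt_floor_add_one s).le ?_
    have : ⌊s⌋₊ < ⌊t⌋₊ + 1 + 1 := (Nat.floor_lt hs).2 (by exact_mod_cast hst)
    omega
  have h2 := h1.congr_of_eventuallyEq (f₁ := fun t => α ⌊t⌋₊ t) ?_ (heq t ht (by linarith))
  · simpa only [heq t ht (by linarith)] using h2
  · filter_upwards [self_mem_nhdsWithin,
      mem_nhdsWithin_of_mem_nhds (Iio_mem_nhds (show t < ⌊t⌋₊ + 1 + 1 by linarith))] with s hs hst
    exact heq s hs hst

/-! ### Differential inequalities -/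

/-- The integrating factor `exp (∫ p)` makes `f` monotone. The sign consequences below turn a level
set `f = 0` into a one-way barrier; derivatives are asked for only at interior times. -/
theorem le_mul_exp_integral_of_deriv_ge {f f' p : ℝ → ℝ} {T : ℝ} (hT : 0 ≤ T)
    (hf : ContinuousOn f (Icc 0 T)) (hp : Continuous p)
    (hd : ∀ t ∈ Ioo 0 T, HasDerivAt f (f' t) t) (h : ∀ t ∈ Ioo 0 T, -(p t * f t) ≤ f' t) :
    f 0 ≤ f T * Real.exp (∫ t in (0 : ℝ)..T, p t) := by
  have hP : ∀ t, HasDerivAt (fun u => ∫ x in (0 : ℝ)..u, p x) (p t) t := fun t =>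
    (hp.integral_hasStrictDerivAt 0 t).hasDerivAt
  have hD : ∀ t ∈ Ioo 0 T, HasDerivAt (fun u => f u * Real.exp (∫ x in (0 : ℝ)..u, p x))
      (f' t * Real.exp (∫ x in (0 : ℝ)..t, p x) +
        f t * (Real.exp (∫ x in (0 : ℝ)..t, p x) * p t)) t := fun t ht =>
    (hd t ht).mul (hP t).exp
  have hmono : MonotoneOn (fun u => f u * Real.exp (∫ x in (0 : ℝ)..u, p x)) (Icc 0 T) := by
    refine monotoneOn_of_deriv_nonneg (convex_Icc _ _) ?_ ?_ ?_
    · exact hf.mul (Real.continuous_exp.comp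
        (continuous_iff_continuousAt.2 fun t => (hP t).continuousAt)).continuousOn
    · rw [interior_Icc]
      exact fun t ht => (hD t ht).differentiableAt.differentiableWithinAt
    · rw [interior_Icc]
      intro t ht
      rw [(hD t ht).deriv]
      have := h t ht
      have he := Real.exp_pos (∫ x in (0 : ℝ)..t, p x)
      nlinarith
  simpa using hmono (left_mem_Icc.2 hT) (right_mem_Icc.2 hT) hT

theorem nonneg_of_deriv_ge {f f' p : ℝ → ℝ} {T : ℝ} (hT : 0 ≤ T)
    (hf : ContinuousOn f (Icc 0 T)) (hp : Continuous p)
    (hd : ∀ t ∈ Ioo 0 T, HasDerivAt f (f' t) t) (h : ∀ t ∈ Ioo 0 T, -(p t * f t) ≤ f' t)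
    (h0 : 0 ≤ f 0) : 0 ≤ f T :=
  nonneg_of_mul_nonneg_left (h0.trans (le_mul_exp_integral_of_deriv_ge hT hf hp hd h))
    (Real.exp_pos _)

theorem pos_of_deriv_ge {f f' p : ℝ → ℝ} {T : ℝ} (hT : 0 ≤ T)
    (hf : ContinuousOn f (Icc 0 T)) (hp : Continuous p)
    (hd : ∀ t ∈ Ioo 0 T, HasDerivAt f (f' t) t) (h : ∀ t ∈ Ioo 0 T, -(p t * f t) ≤ f' t)
    (h0 : 0 < f 0) : 0 < f T :=
  pos_of_mul_pos_left (h0.trans_le (le_mul_exp_integral_of_deriv_ge hT hf hp hd h))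
    (Real.exp_pos _).le

theorem tendsto_atTop_of_eventually_deriv_ge {f f' : ℝ → ℝ} {c : ℝ} (hc : 0 < c)
    (h : ∀ᶠ t in atTop, HasDerivAt f (f' t) t ∧ c ≤ f' t) : Tendsto f atTop atTop := by
  obtain ⟨T, hT⟩ := eventually_atTop.1 h
  have hle : ∀ t ∈ Ici T, f T + c * (t - T) ≤ f t := by
    intro t ht
    have := (convex_Ici T).mul_sub_le_image_sub_of_le_deriv (f := f) (C := c)
      (fun s hs => (hT s hs).1.continuousAt.continuousWithinAt)
      (fun s hs => (hT s (interior_subset hs)).1.differentiableAt.differentiableWithinAt)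
      (fun s hs => by rw [(hT s (interior_subset hs)).1.deriv]; exact (hT s (interior_subset hs)).2)
      T self_mem_Ici t ht ht
    linarith
  refine tendsto_atTop_mono' atTop ((eventually_ge_atTop T).mono hle) ?_
  exact tendsto_atTop_add_const_left _ _
    ((tendsto_atTop_add_const_right _ (-T) tendsto_id).const_mul_atTop hc)

/-! ### The Liénard system `x' = y - b (x ^ (2 n + 1) - x)`, `y' = -x` -/

/-- Coordinates of a solution on `[0, ∞)`, extended continuously to the real line. -/
structure LienardCurve (n : ℕ) (b : ℝ) (x y : ℝ → ℝ) : Prop where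
  continuous_fst : Continuous x
  continuous_snd : Continuous y
  deriv_fst : ∀ t > 0, HasDerivAt x (y t - b * (x t ^ (2 * n + 1) - x t)) t
  deriv_snd : ∀ t > 0, HasDerivAt y (-x t) t

theorem rayleighLienard_neg (n : ℕ) (b : ℝ) (z : ℝ × ℝ) :
    rayleighLienard n (-b) z = (z.2 - b * (z.1 ^ (2 * n + 1) - z.1), -z.1) := by
  unfold rayleighLienard
  ext <;> simp
  ring

theorem contDiff_rayleighLienard (n : ℕ) (a : ℝ) : ContDiff ℝ 1 (rayleighLienard n a) := by
  unfold rayleighLienard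
  fun_prop

theorem rayleighLienard_neg_arg (n : ℕ) (a : ℝ) (z : ℝ × ℝ) :
    rayleighLienard n a (-z) = -rayleighLienard n a z := by
  unfold rayleighLienard
  ext
  · simp only [Prod.fst_neg, Prod.snd_neg, (even_two_mul n).neg_pow]
    ring
  · simp

theorem IsForwardSolution.lienardCurve {n : ℕ} {b : ℝ} {φ : ℝ → ℝ × ℝ}
    (hφ : IsForwardSolution (rayleighLienard n (-b)) φ) :
    LienardCurve n b (fun t => (φ (max t 0)).1) (fun t => (φ (max t 0)).2) := by
  have hc : Continuous fun t => φ (max t 0) :=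
    hφ.continuousOn.comp_continuous (by fun_prop) fun t => le_max_right t 0
  have hd : ∀ t > 0, HasDerivAt (fun t => φ (max t 0)) (rayleighLienard n (-b) (φ (max t 0))) t := by
    intro t ht
    have h1 := (hφ t (le_of_lt ht)).hasDerivAt (Ici_mem_nhds ht)
    rw [max_eq_left (le_of_lt ht)]
    refine h1.congr_of_eventuallyEq ?_
    filter_upwards [Ioi_mem_nhds ht] with s hs
    rw [max_eq_left (le_of_lt hs)]
  refine ⟨hc.fst, hc.snd, fun t ht => ?_, fun t ht => ?_⟩
  · have := (hd t ht).fst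
    rwa [rayleighLienard_neg] at this
  · have := (hd t ht).snd
    rwa [rayleighLienard_neg] at this

/-- This bounds the growth of `x² + y²` by the rate `2 b`, so solutions cannot blow up in finite
positive time. -/
theorem mul_one_sub_pow_le_one (n : ℕ) (u : ℝ) : u ^ 2 * (1 - u ^ (2 * n)) ≤ 1 := by
  rw [pow_mul]
  rcases le_total (u ^ 2) 1 with h | h
  · have := pow_nonneg (sq_nonneg u) n
    nlinarith [sq_nonneg u]
  · have := one_le_pow₀ h (n := n)
    nlinarith [sq_nonneg u]

theorem rayleighLienard_exists_isForwardSolution (n : ℕ) {b : ℝ} (hb : 0 < b) (p : ℝ × ℝ) :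
    ∃ φ : ℝ → ℝ × ℝ, IsForwardSolution (rayleighLienard n (-b)) φ ∧ φ 0 = p := by
  refine exists_isForwardSolution (contDiff_rayleighLienard n (-b)) p fun T hT => ?_
  refine exists_isIntegralCurveOn_Icc (R := Real.sqrt (p.1 ^ 2 + p.2 ^ 2 + 2 * b * T))
    (contDiff_rayleighLienard n (-b)) p hT fun c φ hc h0 hφ t ht => ?_
  have hanti : AntitoneOn (fun t => (φ t).1 ^ 2 + (φ t).2 ^ 2 - 2 * b * t) (Icc 0 T) := by
    have hco : ContinuousOn φ (Icc 0 T) := fun t ht => (hφ t ht).continuousWithinAt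
    have hD : ∀ t ∈ Ioo 0 T, HasDerivAt (fun t => (φ t).1 ^ 2 + (φ t).2 ^ 2 - 2 * b * t)
        (2 * b * (c t * ((φ t).1 ^ 2 * (1 - (φ t).1 ^ (2 * n)))) - 2 * b) t := by
      intro t ht
      have h1 := (hφ t (Ioo_subset_Icc_self ht)).hasDerivAt (Icc_mem_nhds ht.1 ht.2)
      rw [rayleighLienard_neg] at h1
      have h2 : HasDerivAt (fun t => (φ t).1)
          (c t * ((φ t).2 - b * ((φ t).1 ^ (2 * n + 1) - (φ t).1))) t := by
        simpa using h1.hasFDerivAt.fst.hasDerivAt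
      have h3 : HasDerivAt (fun t => (φ t).2) (c t * -(φ t).1) t := by
        simpa using h1.hasFDerivAt.snd.hasDerivAt
      refine (((h2.pow 2).add (h3.pow 2)).sub
        ((hasDerivAt_id t).const_mul (2 * b))).congr_deriv ?_
      push_cast
      ring
    refine antitoneOn_of_deriv_nonpos (convex_Icc _ _) ?_ ?_ ?_
    · exact ((hco.fst.pow 2).add (hco.snd.pow 2)).sub (by fun_prop)
    · rw [interior_Icc]
      exact fun t ht => (hD t ht).differentiableAt.differentiableWithinAt
    · rw [interior_Icc]
      intro t ht
      rw [(hD t ht).deriv]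
      have h1 := mul_one_sub_pow_le_one n (φ t).1
      have h2 : c t * ((φ t).1 ^ 2 * (1 - (φ t).1 ^ (2 * n))) ≤ 1 := by
        have := hc t
        nlinarith [this.1, this.2]
      nlinarith
  have hle := hanti (left_mem_Icc.2 hT) ht ht.1
  simp only [h0] at hle
  have hbt : 2 * b * t ≤ 2 * b * T := by nlinarith [ht.2]
  rw [Prod.norm_def, max_le_iff]
  constructor
  · exact Real.abs_le_sqrt (by nlinarith [sq_nonneg (φ t).2])
  · exact Real.abs_le_sqrt (by nlinarith [sq_nonneg (φ t).1])

/-! ### Forward invariant regions and a barrier line -/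

namespace LienardCurve

variable {n : ℕ} {b : ℝ} {x y : ℝ → ℝ}

/-- The rate of rotation around the origin stays positive once it is positive. -/
theorem rotation_pos (h : LienardCurve n b x y) (hb : 0 < b)
    (h0 : 0 < x 0 ^ 2 + y 0 ^ 2 - y 0 * (b * (x 0 ^ (2 * n + 1) - x 0))) {t : ℝ} (ht : 0 ≤ t) :
    0 < x t ^ 2 + y t ^ 2 - y t * (b * (x t ^ (2 * n + 1) - x t)) := by
  have hx := h.continuous_fst
  have hy := h.continuous_snd
  -- For `M = x² + y² - y F x` one finds `M' = -F' x * M + 2 n b x ^ (2 n + 2)`, so the weight is `p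
  -- = F' x`.
  refine pos_of_deriv_ge (f := fun t => x t ^ 2 + y t ^ 2 - y t * (b * (x t ^ (2 * n + 1) - x t)))
    (p := fun t => b * ((2 * n + 1) * x t ^ (2 * n) - 1)) ht (by fun_prop) (by fun_prop)
    (fun s hs => ((((h.deriv_fst s hs.1).pow 2).add ((h.deriv_snd s hs.1).pow 2)).sub
      ((h.deriv_snd s hs.1).mul ((((h.deriv_fst s hs.1).pow (2 * n + 1)).sub
        (h.deriv_fst s hs.1)).const_mul b)))) (fun s hs => ?_) h0
  have key : 0 ≤ 2 * n * b * (x s ^ (2 * n) * x s ^ 2) := by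
    have : 0 ≤ x s ^ (2 * n) := (even_two_mul n).pow_nonneg _
    positivity
  push_cast [Nat.add_sub_cancel]
  ring_nf at key ⊢
  linarith

/-- Since `x ^ (2 n) ≤ (x² + y²) ^ n`, energy decays no faster than if `x ^ (2 n)` were replaced by
that power. The geometric sum then factors out `x² + y² - 1`, as the differential inequality
requires. -/
theorem one_le_sq_add_sq (h : LienardCurve n b x y) (hb : 0 < b)
    (h0 : 1 ≤ x 0 ^ 2 + y 0 ^ 2) {t : ℝ} (ht : 0 ≤ t) : 1 ≤ x t ^ 2 + y t ^ 2 := by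
  have hx := h.continuous_fst
  have hy := h.continuous_snd
  have := nonneg_of_deriv_ge (f := fun t => x t ^ 2 + y t ^ 2 - 1)
    (p := fun t => 2 * b * x t ^ 2 * ∑ i ∈ Finset.range n, (x t ^ 2 + y t ^ 2) ^ i) ht
    (by fun_prop) (by fun_prop)
    (fun s hs => (((h.deriv_fst s hs.1).pow 2).add ((h.deriv_snd s hs.1).pow 2)).sub_const 1)
    (fun s hs => ?_) (by linarith)
  · linarith
  have hle : x s ^ (2 * n) ≤ (x s ^ 2 + y s ^ 2) ^ n := by
    rw [pow_mul]
    exact pow_le_pow_left₀ (sq_nonneg _) (by nlinarith [sq_nonneg (y s)]) n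
  have hg := geom_sum_mul (x s ^ 2 + y s ^ 2) n
  have hm : 2 * b * x s ^ 2 * x s ^ (2 * n) ≤ 2 * b * x s ^ 2 * (x s ^ 2 + y s ^ 2) ^ n :=
    mul_le_mul_of_nonneg_left hle (by positivity)
  have e : 2 * b * x s ^ 2 * (∑ i ∈ Finset.range n, (x s ^ 2 + y s ^ 2) ^ i) *
      (x s ^ 2 + y s ^ 2 - 1) = 2 * b * x s ^ 2 * ((x s ^ 2 + y s ^ 2) ^ n - 1) := by
    rw [mul_assoc, hg]
  simp only [e]
  push_cast
  ring_nf at hm ⊢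
  linarith

end LienardCurve

/-- A constant bounding `2 u - b (u ^ (2 n + 1) - u)` for `u ≥ 0`. -/
noncomputable def barrierHeight (b : ℝ) : ℝ := (2 + b) * (1 + (2 + b) / b)

/-- Up to `1 + (2 + b) / b` the power may be dropped. Beyond it `u ^ (2 n + 1) ≥ u ^ 2` and `b u ≥ 2
+ b`, so the left side is nonpositive. -/
theorem two_mul_sub_le_barrierHeight {n : ℕ} (hn : 0 < n) {b : ℝ} (hb : 0 < b) {u : ℝ}
    (hu : 0 ≤ u) : 2 * u - b * (u ^ (2 * n + 1) - u) ≤ barrierHeight b := by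
  unfold barrierHeight
  rcases le_total u (1 + (2 + b) / b) with h | h
  · have : 0 ≤ u ^ (2 * n + 1) := by positivity
    have h2 := mul_le_mul_of_nonneg_left h (by linarith : 0 ≤ 2 + b)
    nlinarith
  · have hd : 0 < (2 + b) / b := by positivity
    have h1 : 1 ≤ u := by linarith
    have h2 : u ^ 2 ≤ u ^ (2 * n + 1) := pow_le_pow_right₀ h1 (by omega)
    have h3 : 2 + b ≤ b * u := by
      have := mul_le_mul_of_nonneg_left h hb.le
      have e : b * (1 + (2 + b) / b) = b + (2 + b) := by field_simp
      linarith
    have h4 : 0 < (2 + b) * (1 + (2 + b) / b) := by positivity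
    nlinarith

theorem one_le_barrierHeight {b : ℝ} (hb : 0 < b) : 1 ≤ barrierHeight b := by
  unfold barrierHeight
  have hd : 0 < (2 + b) / b := by positivity
  nlinarith

namespace LienardCurve

variable {n : ℕ} {b : ℝ} {x y : ℝ → ℝ}

/-- In the right half-plane, the line `y = x - barrierHeight b` is crossed upwards. -/
theorem sub_barrierHeight_le (h : LienardCurve n b x y) (hn : 0 < n) (hb : 0 < b)
    (h0 : 0 ≤ y 0 - x 0 + barrierHeight b) {t : ℝ} (ht : 0 ≤ t)
    (hx0 : ∀ s ∈ Icc 0 t, 0 ≤ x s) : x t - barrierHeight b ≤ y t := by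
  have hx := h.continuous_fst
  have hy := h.continuous_snd
  -- For this `f`, the inequality `f' ≥ -f` is exactly `2 x - F x ≤ barrierHeight b`.
  have := nonneg_of_deriv_ge (f := fun t => y t - x t + barrierHeight b) (p := fun _ => 1) ht
    (by fun_prop) (by fun_prop)
    (fun s hs => ((h.deriv_snd s hs.1).sub (h.deriv_fst s hs.1)).add_const _)
    (fun s hs => ?_) h0
  · linarith
  · have := two_mul_sub_le_barrierHeight hn hb (hx0 s (Ioo_subset_Icc_self hs))
    linarith

theorem snd_le (h : LienardCurve n b x y) {t : ℝ} (ht : 0 ≤ t)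
    (hx0 : ∀ s ∈ Icc 0 t, 0 ≤ x s) : y t ≤ y 0 := by
  have hy := h.continuous_snd
  have := nonneg_of_deriv_ge (f := fun t => y 0 - y t) (p := fun _ => 0) ht
    (by fun_prop) (by fun_prop) (fun s hs => (h.deriv_snd s hs.1).const_sub _)
    (fun s hs => ?_) (by simp)
  · linarith
  · simpa using hx0 s (Ioo_subset_Icc_self hs)

end LienardCurve

/-! ### Polar coordinates `x = exp ρ * sin s`, `y = exp ρ * cos s` -/

/-- The quotient `F x / x` of the friction term, in polar coordinates. -/
noncomputable def polarFriction (n : ℕ) (b ρ s : ℝ) : ℝ :=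
  b * ((Real.exp ρ * Real.sin s) ^ (2 * n) - 1)

/-- The angular speed of the Liénard system. -/
noncomputable def polarSpeed (n : ℕ) (b ρ s : ℝ) : ℝ :=
  1 - Real.cos s * Real.sin s * polarFriction n b ρ s

/-- Polar coordinates of a solution on `[0, ∞)` that rotates around the origin. -/
structure PolarCurve (n : ℕ) (b : ℝ) (ρ s : ℝ → ℝ) : Prop where
  continuous_radius : Continuous ρ
  exists_hasStrictDerivAt : ∀ t, ∃ c > 0, HasStrictDerivAt s c t
  deriv_angle : ∀ t ≥ 0, HasDerivAt s (polarSpeed n b (ρ t) (s t)) t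
  deriv_radius : ∀ t > 0,
    HasDerivAt ρ (-(Real.sin (s t) ^ 2 * polarFriction n b (ρ t) (s t))) t

theorem sq_add_sq_pos_of_rotation_pos {u v b : ℝ} {n : ℕ}
    (h : 0 < u ^ 2 + v ^ 2 - v * (b * (u ^ (2 * n + 1) - u))) : 0 < u ^ 2 + v ^ 2 := by
  rcases eq_or_ne u 0 with rfl | hu
  · simpa using h
  · positivity

theorem LienardCurve.exists_polarCurve {n : ℕ} {b : ℝ} {x y : ℝ → ℝ}
    (h : LienardCurve n b x y)
    (hpos : ∀ t, 0 < x t ^ 2 + y t ^ 2 - y t * (b * (x t ^ (2 * n + 1) - x t))) {ρ₀ s₀ : ℝ}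
    (hx0 : x 0 = Real.exp ρ₀ * Real.sin s₀) (hy0 : y 0 = Real.exp ρ₀ * Real.cos s₀) :
    ∃ ρ s : ℝ → ℝ, PolarCurve n b ρ s ∧ ρ 0 = ρ₀ ∧ s 0 = s₀ ∧
      ∀ t ≥ 0, x t = Real.exp (ρ t) * Real.sin (s t) ∧ y t = Real.exp (ρ t) * Real.cos (s t) := by
  have hx := h.continuous_fst
  have hy := h.continuous_snd
  have he : ∀ t, 0 < x t ^ 2 + y t ^ 2 := fun t => sq_add_sq_pos_of_rotation_pos (hpos t)
  set ρ : ℝ → ℝ := fun t => Real.log (x t ^ 2 + y t ^ 2) / 2 with hρ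
  have hρexp : ∀ t, Real.exp (ρ t) ^ 2 = x t ^ 2 + y t ^ 2 := fun t => by
    rw [← Real.exp_nat_mul]
    simp only [hρ]
    rw [show ((2 : ℕ) : ℝ) * (Real.log (x t ^ 2 + y t ^ 2) / 2) = Real.log (x t ^ 2 + y t ^ 2) by
      push_cast; ring, Real.exp_log (he t)]
  have hρc : Continuous ρ :=
    (Continuous.log (by fun_prop) fun t => (he t).ne').div_const 2
  set c : ℝ → ℝ := fun t => (x t ^ 2 + y t ^ 2 - y t * (b * (x t ^ (2 * n + 1) - x t))) /
    (x t ^ 2 + y t ^ 2) with hc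
  have hcc : Continuous c :=
    Continuous.div (by fun_prop) (by fun_prop) fun t => (he t).ne'
  have hcpos : ∀ t, 0 < c t := fun t => div_pos (hpos t) (he t)
  -- Integrating the angular speed avoids branches of the argument. It also gives a strict, positive
  -- derivative on all of `ℝ`, so the inverse of `s` is well behaved even at the initial angle.
  set s : ℝ → ℝ := fun t => s₀ + ∫ u in (0 : ℝ)..t, c u with hs
  have hsd : ∀ t, HasStrictDerivAt s (c t) t := fun t =>
    (hcc.integral_hasStrictDerivAt 0 t).const_add s₀
  have hsc : Continuous s := continuous_iff_continuousAt.2 fun t => (hsd t).hasDerivAt.continuousAt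
  have hρd : ∀ t > 0, HasDerivAt ρ
      (-(x t * (b * (x t ^ (2 * n + 1) - x t))) / (x t ^ 2 + y t ^ 2)) t := fun t ht => by
    refine ((((h.deriv_fst t ht).pow 2).add ((h.deriv_snd t ht).pow 2)).log
      (he t).ne').div_const 2 |>.congr_deriv ?_
    field_simp
    simp only [Pi.add_apply, Pi.pow_apply]
    push_cast
    field_simp [(he t).ne']
    ring
  have hs0 : s 0 = s₀ := by simp [hs]
  have hρ0 : ρ 0 = ρ₀ := by
    have : x 0 ^ 2 + y 0 ^ 2 = Real.exp ρ₀ ^ 2 := by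
      rw [hx0, hy0]
      linear_combination (Real.exp ρ₀ ^ 2) * Real.sin_sq_add_cos_sq s₀
    simp only [hρ, this, Real.log_pow, Real.log_exp]
    push_cast
    ring
  have hX : ∀ t > 0, HasDerivAt (fun t => x t * Real.exp (-ρ t))
      (c t * (y t * Real.exp (-ρ t))) t := fun t ht => by
    refine ((h.deriv_fst t ht).mul (hρd t ht).neg.exp).congr_deriv ?_
    simp only [hc, Pi.neg_apply]
    field_simp [(he t).ne']
    ring
  have hY : ∀ t > 0, HasDerivAt (fun t => y t * Real.exp (-ρ t))
      (-(c t * (x t * Real.exp (-ρ t)))) t := fun t ht => by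
    refine ((h.deriv_snd t ht).mul (hρd t ht).neg.exp).congr_deriv ?_
    simp only [hc, Pi.neg_apply]
    field_simp [(he t).ne']
    ring
  have hconst : ∀ {f : ℝ → ℝ}, Continuous f → (∀ t > 0, HasDerivAt f 0 t) →
      ∀ t ≥ 0, f t = f 0 := fun {f} hf hd t ht => by
    refine constant_of_has_deriv_right_zero (a := 0) (b := t + 1) hf.continuousOn ?_ t ⟨ht, by linarith⟩
    intro u hu
    rcases hu.1.eq_or_lt with rfl | h0
    · have h1 : HasDerivWithinAt f (0 : ℝ) (Ici 0) 0 := by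
        refine hasDerivWithinAt_Ici_of_tendsto_deriv (s := Ioi 0)
          (fun v hv => (hd v hv).differentiableAt.differentiableWithinAt)
          hf.continuousWithinAt self_mem_nhdsWithin ?_
        refine tendsto_const_nhds.congr' ?_
        filter_upwards [self_mem_nhdsWithin] with v hv
        exact ((hd v hv).deriv).symm
      exact h1
    · exact (hd u h0).hasDerivWithinAt
  -- The unit vector `(x, y) * exp (-ρ)` turns at speed `c`, so its components in the frame turning
  -- with `s` are constant: `0` here and `1` in the next claim.
  have hu : ∀ t ≥ 0, x t * Real.exp (-ρ t) * Real.cos (s t) -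
      y t * Real.exp (-ρ t) * Real.sin (s t) = 0 := by
    intro t ht
    have := hconst (f := fun t => x t * Real.exp (-ρ t) * Real.cos (s t) -
      y t * Real.exp (-ρ t) * Real.sin (s t)) (by fun_prop) (fun t ht =>
        (((hX t ht).mul (hsd t).hasDerivAt.cos).sub
          ((hY t ht).mul (hsd t).hasDerivAt.sin)).congr_deriv (by ring)) t ht
    rw [this, hx0, hy0, hs0]
    ring
  have hv : ∀ t ≥ 0, x t * Real.exp (-ρ t) * Real.sin (s t) +
      y t * Real.exp (-ρ t) * Real.cos (s t) = 1 := by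
    intro t ht
    have := hconst (f := fun t => x t * Real.exp (-ρ t) * Real.sin (s t) +
      y t * Real.exp (-ρ t) * Real.cos (s t)) (by fun_prop) (fun t ht =>
        (((hX t ht).mul (hsd t).hasDerivAt.sin).add
          ((hY t ht).mul (hsd t).hasDerivAt.cos)).congr_deriv (by ring)) t ht
    rw [this, hx0, hy0, hs0, hρ0, Real.exp_neg]
    field_simp
    exact Real.sin_sq_add_cos_sq s₀
  have hxy : ∀ t ≥ 0, x t = Real.exp (ρ t) * Real.sin (s t) ∧
      y t = Real.exp (ρ t) * Real.cos (s t) := by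
    intro t ht
    have h1 := hu t ht
    have h2 := hv t ht
    have h3 := Real.sin_sq_add_cos_sq (s t)
    have h4 : Real.exp (ρ t) * Real.exp (-ρ t) = 1 := by rw [← Real.exp_add]; simp
    constructor
    · linear_combination Real.exp (ρ t) * Real.cos (s t) * h1 + Real.exp (ρ t) * Real.sin (s t) * h2
        - x t * h4 - (Real.exp (ρ t) * Real.exp (-ρ t)) * x t * h3
    · linear_combination -Real.exp (ρ t) * Real.sin (s t) * h1 + Real.exp (ρ t) * Real.cos (s t) * h2
        - y t * h4 - (Real.exp (ρ t) * Real.exp (-ρ t)) * y t * h3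
  refine ⟨ρ, s, ⟨hρc, fun t => ⟨c t, hcpos t, hsd t⟩, fun t ht => ?_, fun t ht => ?_⟩, hρ0, hs0, hxy⟩
  · refine (hsd t).hasDerivAt.congr_deriv ?_
    have h1 := (hρexp t).symm
    have h2 := Real.exp_pos (ρ t)
    simp only [hc, polarSpeed, polarFriction]
    rw [h1, (hxy t ht).1, (hxy t ht).2]
    field_simp
    ring
  · refine (hρd t ht).congr_deriv ?_
    have h1 := (hρexp t).symm
    have h2 := Real.exp_pos (ρ t)
    simp only [polarFriction]
    rw [h1, (hxy t ht.le).1]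
    field_simp
    ring

/-- The (logarithmic) radius of a polar curve as a function of its angle. -/
noncomputable def radiusAt (ρ s : ℝ → ℝ) (σ : ℝ) : ℝ := ρ (Function.invFun s σ)

theorem abs_polarFriction_le {n : ℕ} {b ρ B : ℝ} (hb : 0 < b) (hρ : ρ ≤ B) (s : ℝ) :
    |polarFriction n b ρ s| ≤ b * (Real.exp B ^ (2 * n) + 1) := by
  unfold polarFriction
  rw [abs_mul, abs_of_pos hb]
  refine mul_le_mul_of_nonneg_left ((abs_sub _ _).trans ?_) hb.le
  rw [abs_one, abs_pow, abs_mul, abs_of_pos (Real.exp_pos _)]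
  have h1 : Real.exp ρ * |Real.sin s| ≤ Real.exp B := by
    have h2 := Real.exp_le_exp.2 hρ
    have h3 := Real.abs_sin_le_one s
    have h4 := Real.exp_pos ρ
    nlinarith
  have := pow_le_pow_left₀ (by positivity) h1 (2 * n)
  linarith

/-- The factor `|sin s|` shows that the speed is close to `1` near the `y`-axis, so the angle cannot
stall there. -/
theorem abs_polarSpeed_sub_one_le {n : ℕ} {b ρ B : ℝ} (hb : 0 < b) (hρ : ρ ≤ B) (s : ℝ) :
    |polarSpeed n b ρ s - 1| ≤ |Real.sin s| * (b * (Real.exp B ^ (2 * n) + 1)) := by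
  have h1 := abs_polarFriction_le (n := n) hb hρ s
  have h2 := Real.abs_cos_le_one s
  unfold polarSpeed
  rw [sub_sub_cancel_left, abs_neg, abs_mul, abs_mul]
  refine mul_le_mul ?_ h1 (abs_nonneg _) (abs_nonneg _)
  exact mul_le_of_le_one_left (abs_nonneg _) h2

theorem polarSpeed_le {n : ℕ} {b ρ B : ℝ} (hb : 0 < b) (hρ : ρ ≤ B) (s : ℝ) :
    polarSpeed n b ρ s ≤ 1 + b * (Real.exp B ^ (2 * n) + 1) := by
  have h1 := abs_polarSpeed_sub_one_le (n := n) hb hρ s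
  have h2 := le_abs_self (polarSpeed n b ρ s - 1)
  have h3 : |Real.sin s| * (b * (Real.exp B ^ (2 * n) + 1)) ≤ b * (Real.exp B ^ (2 * n) + 1) :=
    mul_le_of_le_one_left (by positivity) (Real.abs_sin_le_one s)
  linarith

theorem tendsto_integral_sin_pow_atTop (n : ℕ) :
    Tendsto (fun σ => ∫ u in (0 : ℝ)..σ, Real.sin u ^ (2 * n + 2)) atTop atTop := by
  have hp : Function.Periodic (fun u => Real.sin u ^ (2 * n + 2)) Real.pi := fun u => by
    have : Even (2 * n + 2) := ⟨n + 1, by ring⟩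
    simp only [Real.sin_add_pi, this.neg_pow]
  exact hp.tendsto_atTop_intervalIntegral_of_pos (integral_sin_pow_pos _) Real.pi_pos

/-- Convexity of `exp` makes its monotonicity quantitative: a gap of at least `ε` contracts at a
definite rate. -/
theorem le_mul_exp_sub_exp {k A ε u v : ℝ} (hk : 0 < k) (hu : A ≤ u) (hv : A ≤ v) (hε : 0 ≤ ε)
    (h : ε ≤ |u - v|) :
    Real.exp (k * A) * k * ε ^ 2 ≤ (u - v) * (Real.exp (k * u) - Real.exp (k * v)) := by
  wlog huv : v ≤ u generalizing u v
  · have := this hv hu (by rwa [abs_sub_comm]) (le_of_not_ge huv)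
    linarith
  rw [abs_of_nonneg (sub_nonneg.2 huv)] at h
  have h1 : Real.exp (k * v) * (k * (u - v)) ≤ Real.exp (k * u) - Real.exp (k * v) := by
    have h2 := Real.add_one_le_exp (k * (u - v))
    have h3 : Real.exp (k * u) = Real.exp (k * v) * Real.exp (k * (u - v)) := by
      rw [← Real.exp_add]; ring_nf
    have h4 := Real.exp_pos (k * v)
    nlinarith
  have h5 : Real.exp (k * A) ≤ Real.exp (k * v) := Real.exp_le_exp.2 (by nlinarith)
  have h6 : ε ^ 2 ≤ (u - v) ^ 2 := pow_le_pow_left₀ hε h 2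
  calc Real.exp (k * A) * k * ε ^ 2 ≤ Real.exp (k * v) * k * (u - v) ^ 2 := by gcongr
    _ = (u - v) * (Real.exp (k * v) * (k * (u - v))) := by ring
    _ ≤ _ := mul_le_mul_of_nonneg_left h1 (sub_nonneg.2 huv)

/-! ### Comparison of polar curves at equal angles -/

namespace PolarCurve

variable {n : ℕ} {b : ℝ} {ρ s ρ₁ s₁ ρ₂ s₂ : ℝ → ℝ}

theorem continuous_angle (h : PolarCurve n b ρ s) : Continuous s :=
  continuous_iff_continuousAt.2 fun t =>
    let ⟨_, _, hd⟩ := h.exists_hasStrictDerivAt t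
    hd.hasDerivAt.continuousAt

theorem strictMono_angle (h : PolarCurve n b ρ s) : StrictMono s :=
  strictMono_of_deriv_pos fun t => by
    obtain ⟨c, hc, hd⟩ := h.exists_hasStrictDerivAt t
    rwa [hd.hasDerivAt.deriv]

theorem speed_pos (h : PolarCurve n b ρ s) {t : ℝ} (ht : 0 ≤ t) :
    0 < polarSpeed n b (ρ t) (s t) := by
  obtain ⟨c, hc, hd⟩ := h.exists_hasStrictDerivAt t
  rwa [(h.deriv_angle t ht).unique hd.hasDerivAt]

theorem invFun_angle (h : PolarCurve n b ρ s) (t : ℝ) : Function.invFun s (s t) = t :=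
  Function.leftInverse_invFun h.strictMono_angle.injective t

theorem radiusAt_angle (h : PolarCurve n b ρ s) (t : ℝ) : radiusAt ρ s (s t) = ρ t := by
  rw [radiusAt, h.invFun_angle]

theorem continuousAt_radiusAt (h : PolarCurve n b ρ s) (t : ℝ) :
    ContinuousAt (radiusAt ρ s) (s t) := by
  obtain ⟨c, hc, hd⟩ := h.exists_hasStrictDerivAt t
  have := (hd.to_local_left_inverse hc.ne' (g := Function.invFun s)
    (Eventually.of_forall h.invFun_angle)).hasDerivAt.continuousAt
  exact ContinuousAt.comp (f := Function.invFun s) h.continuous_radius.continuousAt this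

theorem hasDerivAt_radiusAt (h : PolarCurve n b ρ s) {t : ℝ} (ht : 0 < t) :
    HasDerivAt (radiusAt ρ s) (-(Real.sin (s t) ^ 2 * polarFriction n b (ρ t) (s t)) *
      (polarSpeed n b (ρ t) (s t))⁻¹) (s t) := by
  obtain ⟨c, hc, hd⟩ := h.exists_hasStrictDerivAt t
  rw [(h.deriv_angle t ht.le).unique hd.hasDerivAt]
  have h1 := (hd.to_local_left_inverse hc.ne' (g := Function.invFun s)
    (Eventually.of_forall h.invFun_angle)).hasDerivAt
  have h2 : HasDerivAt ρ (-(Real.sin (s t) ^ 2 * polarFriction n b (ρ t) (s t)))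
      (Function.invFun s (s t)) := by
    rw [h.invFun_angle]
    exact h.deriv_radius t ht
  exact h2.comp (s t) h1

/-- The difference of the radii of two polar curves at equal angles. -/
theorem hasDerivAt_radius_sub (h₁ : PolarCurve n b ρ₁ s₁) (h₂ : PolarCurve n b ρ₂ s₂)
    {t u : ℝ} (ht : 0 < t) (hu : 0 < u) (htu : s₂ u = s₁ t) :
    HasDerivAt (fun t => ρ₁ t - radiusAt ρ₂ s₂ (s₁ t))
      (-(b * Real.sin (s₁ t) ^ (2 * n + 2) *
        (Real.exp (2 * n * ρ₁ t) - Real.exp (2 * n * ρ₂ u)) /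
          polarSpeed n b (ρ₂ u) (s₂ u))) t := by
  have h3 := h₂.hasDerivAt_radiusAt hu
  rw [htu] at h3
  -- With `gᵢ = F x / x` and speeds `Dᵢ = 1 - sin cos gᵢ`, the terms in `g₁ g₂` cancel: `-sin² g₁ +
  -- D₁ sin² g₂ / D₂ = -sin² (g₁ - g₂) / D₂`.
  refine ((h₁.deriv_radius t ht).sub (h3.comp t (h₁.deriv_angle t ht.le))).congr_deriv ?_
  have h4 := h₂.speed_pos hu.le
  rw [htu] at h4 ⊢
  field_simp
  unfold polarSpeed polarFriction
  have e1 : ∀ r : ℝ, Real.exp (2 * n * r) = Real.exp r ^ (2 * n) := fun r => by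
    rw [← Real.exp_nat_mul]
    push_cast
    rfl
  rw [e1, e1]
  simp only [mul_pow]
  ring

/-- The square of the gap decreases because `exp` is monotone. Positive matching times are needed
only in the interior of `S`, since an endpoint may match time `0` of the second curve, where
continuity suffices. -/
theorem abs_radius_sub_antitoneOn (h₁ : PolarCurve n b ρ₁ s₁) (h₂ : PolarCurve n b ρ₂ s₂)
    (hb : 0 < b) {S : Set ℝ} (hS : Convex ℝ S) (hS0 : S ⊆ Ici 0)
    (hmem : ∀ t ∈ S, ∃ u, s₂ u = s₁ t) (hmem' : ∀ t ∈ interior S, ∃ u > 0, s₂ u = s₁ t) :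
    AntitoneOn (fun t => |ρ₁ t - radiusAt ρ₂ s₂ (s₁ t)|) S := by
  have hpos : ∀ t ∈ interior S, 0 < t := fun t ht => by
    have := interior_mono hS0 ht
    rwa [interior_Ici] at this
  have hsq : AntitoneOn (fun t => (ρ₁ t - radiusAt ρ₂ s₂ (s₁ t)) ^ 2) S := by
    refine antitoneOn_of_deriv_nonpos hS ?_ ?_ ?_
    · intro t ht
      obtain ⟨u, hu⟩ := hmem t ht
      have h3 := h₂.continuousAt_radiusAt u
      rw [hu] at h3
      exact ((h₁.continuous_radius.continuousAt.sub
        (h3.comp h₁.continuous_angle.continuousAt)).pow 2).continuousWithinAt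
    · intro t ht
      obtain ⟨u, hu0, hu⟩ := hmem' t ht
      exact ((h₁.hasDerivAt_radius_sub h₂ (hpos t ht) hu0 hu).pow 2).differentiableAt.differentiableWithinAt
    · intro t ht
      obtain ⟨u, hu0, hu⟩ := hmem' t ht
      have hd := (h₁.hasDerivAt_radius_sub h₂ (hpos t ht) hu0 hu).pow 2
      have hD := h₂.speed_pos hu0.le
      have h4 : 0 ≤ (ρ₁ t - ρ₂ u) * (Real.exp (2 * n * ρ₁ t) - Real.exp (2 * n * ρ₂ u)) := by
        rcases le_total (ρ₁ t) (ρ₂ u) with h | h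
        · exact mul_nonneg_of_nonpos_of_nonpos (by linarith)
            (sub_nonpos.2 (Real.exp_le_exp.2 (by gcongr)))
        · exact mul_nonneg (by linarith) (sub_nonneg.2 (Real.exp_le_exp.2 (by gcongr)))
      have h5 : 0 ≤ Real.sin (s₁ t) ^ (2 * n + 2) := Even.pow_nonneg ⟨n + 1, by ring⟩ _
      have h6 : 0 ≤ 2 * b * Real.sin (s₁ t) ^ (2 * n + 2) * ((ρ₁ t - ρ₂ u) *
          (Real.exp (2 * n * ρ₁ t) - Real.exp (2 * n * ρ₂ u))) / polarSpeed n b (ρ₂ u) (s₂ u) := by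
        positivity
      have hr : radiusAt ρ₂ s₂ (s₁ t) = ρ₂ u := by rw [← hu, h₂.radiusAt_angle]
      refine (hd.deriv.trans_le ?_)
      rw [hr]
      refine le_of_eq_of_le ?_ (neg_nonpos.2 h6)
      push_cast
      ring
  intro t ht u hu htu
  exact sq_le_sq.1 (hsq ht hu htu)

/-- A polar curve staying in an annulus makes infinitely many turns. -/
theorem tendsto_angle_atTop (h : PolarCurve n b ρ s) (hb : 0 < b) {A B : ℝ}
    (hA : ∀ t ≥ 0, A ≤ ρ t) (hB : ∀ t ≥ 0, ρ t ≤ B) : Tendsto s atTop atTop := by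
  rcases tendsto_atTop_of_monotone h.strictMono_angle.monotone with hs | ⟨l, hl⟩
  · exact hs
  exfalso
  have hsin : Tendsto (fun t => Real.sin (s t)) atTop (𝓝 (Real.sin l)) :=
    (Real.continuous_sin.tendsto l).comp hl
  -- If the limit direction is on the `y`-axis, the speed tends to `1`. Otherwise `y' = -x` keeps a
  -- fixed sign and size, so `y` is unbounded. Both are impossible.
  by_cases hl0 : Real.sin l = 0
  · have hlim : Tendsto (fun t => |Real.sin (s t)| * (b * (Real.exp B ^ (2 * n) + 1))) atTop (𝓝 0) := by
      have := (hsin.abs).mul_const (b * (Real.exp B ^ (2 * n) + 1))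
      simpa [hl0] using this
    refine not_tendsto_nhds_of_tendsto_atTop
      (tendsto_atTop_of_eventually_deriv_ge (f := s) (c := 1 / 2) (by norm_num)
        (f' := fun t => polarSpeed n b (ρ t) (s t)) ?_) l hl
    filter_upwards [hlim.eventually (gt_mem_nhds (show (0 : ℝ) < 1 / 2 by norm_num)),
      eventually_ge_atTop 0] with t ht ht0
    refine ⟨h.deriv_angle t ht0, ?_⟩
    have h1 := abs_polarSpeed_sub_one_le (n := n) hb (hB t ht0) (s t)
    have h2 := neg_abs_le (polarSpeed n b (ρ t) (s t) - 1)
    linarith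
  · have hp : 0 < Real.sin l ^ 2 := by positivity
    have hlim : Tendsto (fun t => Real.sin l * Real.sin (s t)) atTop (𝓝 (Real.sin l ^ 2)) := by
      simpa [sq] using hsin.const_mul (Real.sin l)
    have htop := tendsto_atTop_of_eventually_deriv_ge
      (f := fun t => -(Real.sin l * (Real.exp (ρ t) * Real.cos (s t))))
      (c := Real.exp A * (Real.sin l ^ 2 / 2)) (by positivity)
      (f' := fun t => Real.exp (ρ t) * (Real.sin l * Real.sin (s t))) (by
        filter_upwards [hlim.eventually (lt_mem_nhds (show Real.sin l ^ 2 / 2 < Real.sin l ^ 2 by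
          linarith)), eventually_gt_atTop 0] with t ht ht0
        constructor
        · refine ((((h.deriv_radius t ht0).exp).mul
            (h.deriv_angle t ht0.le).cos).const_mul (Real.sin l)).neg.congr_deriv ?_
          unfold polarSpeed
          ring
        · exact mul_le_mul (Real.exp_le_exp.2 (hA t ht0.le)) ht.le (by positivity)
            (Real.exp_pos _).le)
    obtain ⟨t, ht, ht0⟩ := ((htop.eventually_gt_atTop (Real.exp B)).and
      (eventually_ge_atTop 0)).exists
    have h1 : |Real.sin l * (Real.exp (ρ t) * Real.cos (s t))| ≤ Real.exp B := by
      rw [abs_mul, abs_mul, abs_of_pos (Real.exp_pos _)]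
      have h2 := Real.abs_sin_le_one l
      have h3 := Real.abs_cos_le_one (s t)
      have h4 := Real.exp_le_exp.2 (hB t ht0)
      calc |Real.sin l| * (Real.exp (ρ t) * |Real.cos (s t)|)
          ≤ 1 * (Real.exp B * 1) := by gcongr
        _ = Real.exp B := by ring
    have := neg_abs_le (Real.sin l * (Real.exp (ρ t) * Real.cos (s t)))
    linarith

theorem exists_angle_eq (h : PolarCurve n b ρ s) (hs : Tendsto s atTop atTop) {σ : ℝ}
    (hσ : s 0 < σ) : ∃ u > 0, s u = σ := by
  obtain ⟨T, hT, hT0⟩ := ((hs.eventually_ge_atTop σ).and (eventually_ge_atTop 0)).exists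
  obtain ⟨u, hu, rfl⟩ := intermediate_value_Icc hT0 h.continuous_angle.continuousOn ⟨hσ.le, hT⟩
  exact ⟨u, h.strictMono_angle.lt_iff_lt.1 hσ, rfl⟩

theorem exists_angle_eq_of_lt (h₁ : PolarCurve n b ρ₁ s₁) (h₂ : PolarCurve n b ρ₂ s₂)
    (hs₂ : Tendsto s₂ atTop atTop) (h0 : s₂ 0 < s₁ 0) {t : ℝ} (ht : 0 ≤ t) :
    ∃ u > 0, s₂ u = s₁ t :=
  h₂.exists_angle_eq hs₂ (h0.trans_le (h₁.strictMono_angle.monotone ht))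

theorem abs_radius_sub_antitoneOn_Ici (h₁ : PolarCurve n b ρ₁ s₁) (h₂ : PolarCurve n b ρ₂ s₂)
    (hb : 0 < b) (hs₂ : Tendsto s₂ atTop atTop) (h0 : s₂ 0 < s₁ 0) :
    AntitoneOn (fun t => |ρ₁ t - radiusAt ρ₂ s₂ (s₁ t)|) (Ici 0) :=
  h₁.abs_radius_sub_antitoneOn h₂ hb (convex_Ici 0) subset_rfl
    (fun _ ht => let ⟨u, _, hu⟩ := h₁.exists_angle_eq_of_lt h₂ hs₂ h0 ht; ⟨u, hu⟩)
    (fun _ ht => h₁.exists_angle_eq_of_lt h₂ hs₂ h0 (interior_subset ht))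

/-- A polar curve that stays in an annulus attracts all other polar curves. -/
theorem tendsto_radius_sub (h₁ : PolarCurve n b ρ₁ s₁) (h₂ : PolarCurve n b ρ₂ s₂)
    (hn : 0 < n) (hb : 0 < b) {A B : ℝ} (hA : ∀ t ≥ 0, A ≤ ρ₂ t) (hB : ∀ t ≥ 0, ρ₂ t ≤ B)
    (h0 : s₂ 0 < s₁ 0) :
    Tendsto (fun t => ρ₁ t - radiusAt ρ₂ s₂ (s₁ t)) atTop (𝓝 0) := by
  have hs₂ := h₂.tendsto_angle_atTop hb hA hB
  have hanti := h₁.abs_radius_sub_antitoneOn_Ici h₂ hb hs₂ h0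
  set δ : ℝ → ℝ := fun t => ρ₁ t - radiusAt ρ₂ s₂ (s₁ t) with hδ
  set d := |δ 0| with hd
  have hd0 : 0 ≤ d := abs_nonneg _
  have hu : ∀ t ≥ 0, ∃ u > 0, s₂ u = s₁ t := fun t ht => h₁.exists_angle_eq_of_lt h₂ hs₂ h0 ht
  have hδd : ∀ t ≥ 0, |δ t| ≤ d := fun t ht => hanti self_mem_Ici ht ht
  have hbd : ∀ t ≥ 0, A - d ≤ ρ₁ t ∧ ρ₁ t ≤ B + d := by
    intro t ht
    obtain ⟨u, hu0, hut⟩ := hu t ht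
    have h3 : δ t = ρ₁ t - ρ₂ u := by rw [← h₂.radiusAt_angle u, hut]
    have h4 := abs_le.1 (hδd t ht)
    have h5 := hA u hu0.le
    have h6 := hB u hu0.le
    constructor <;> linarith [h4.1, h4.2]
  have hs₁ := h₁.tendsto_angle_atTop hb (fun t ht => (hbd t ht).1) (fun t ht => (hbd t ht).2)
  suffices hε : ∀ ε > 0, ∃ t ≥ 0, |δ t| < ε by
    rw [Metric.tendsto_atTop]
    intro ε hεp
    obtain ⟨t, ht, htε⟩ := hε ε hεp
    exact ⟨t, fun u hut => by
      rw [Real.dist_0_eq_abs]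
      exact (hanti ht (ht.le.trans hut) hut).trans_lt htε⟩
  intro ε hε
  by_contra! hcon
  set D₁ := 1 + b * (Real.exp (B + d) ^ (2 * n) + 1) with hD₁
  set D₂ := 1 + b * (Real.exp B ^ (2 * n) + 1) with hD₂
  have hD₁p : 0 < D₁ := by positivity
  have hD₂p : 0 < D₂ := by positivity
  set m := Real.exp (2 * n * (A - d)) * (2 * n) * ε ^ 2 with hm
  have hmp : 0 < m := by
    have : (0 : ℝ) < n := by exact_mod_cast hn
    positivity
  -- Chosen so that `κ D₁ = 2 b m / D₂`: the decay of `δ ^ 2` then dominates the growth of `κ` times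
  -- the integral of `sin ^ (2 n + 2)`.
  set κ := 2 * b * m / (D₁ * D₂) with hκ
  have hκp : 0 < κ := by positivity
  have hsc : Continuous fun u => Real.sin u ^ (2 * n + 2) := by fun_prop
  have hΦ : ∀ σ, HasDerivAt (fun σ => ∫ u in (0 : ℝ)..σ, Real.sin u ^ (2 * n + 2))
      (Real.sin σ ^ (2 * n + 2)) σ := fun σ => (hsc.integral_hasStrictDerivAt 0 σ).hasDerivAt
  have hmono : AntitoneOn (fun t => δ t ^ 2 +
      κ * ∫ u in (0 : ℝ)..s₁ t, Real.sin u ^ (2 * n + 2)) (Ici 0) := by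
    have hD : ∀ t > 0, ∃ f' ≤ 0, HasDerivAt (fun t => δ t ^ 2 +
        κ * ∫ u in (0 : ℝ)..s₁ t, Real.sin u ^ (2 * n + 2)) f' t := by
      intro t ht
      obtain ⟨u, hu0, hut⟩ := hu t ht.le
      have h3 : δ t = ρ₁ t - ρ₂ u := by rw [← h₂.radiusAt_angle u, hut]
      refine ⟨_, ?_, ((h₁.hasDerivAt_radius_sub h₂ ht hu0 hut).pow 2).add
        (((hΦ (s₁ t)).comp t (h₁.deriv_angle t ht.le)).const_mul κ)⟩
      have hkey := le_mul_exp_sub_exp (k := 2 * n) (A := A - d) (u := ρ₁ t) (v := ρ₂ u)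
        (by have : (0 : ℝ) < n := by exact_mod_cast hn
            positivity)
        (hbd t ht.le).1 (by linarith [hA u hu0.le]) hε.le (by rw [← h3]; exact hcon t ht.le)
      have hspeed₁ := polarSpeed_le (n := n) hb (hbd t ht.le).2 (s₁ t)
      have hspeed₂ := polarSpeed_le (n := n) hb (hB u hu0.le) (s₂ u)
      have hp₂ := h₂.speed_pos hu0.le
      have h5 : 0 ≤ Real.sin (s₁ t) ^ (2 * n + 2) := Even.pow_nonneg ⟨n + 1, by ring⟩ _
      have h6 : κ * polarSpeed n b (ρ₁ t) (s₁ t) ≤ 2 * b * ((ρ₁ t - ρ₂ u) *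
          (Real.exp (2 * n * ρ₁ t) - Real.exp (2 * n * ρ₂ u))) / polarSpeed n b (ρ₂ u) (s₂ u) := by
        calc κ * polarSpeed n b (ρ₁ t) (s₁ t) ≤ κ * D₁ := by gcongr
          _ = 2 * b * m / D₂ := by rw [hκ]; field_simp
          _ ≤ 2 * b * m / polarSpeed n b (ρ₂ u) (s₂ u) := by gcongr
          _ ≤ _ := by gcongr
      have h7 := mul_le_mul_of_nonneg_left h6 h5
      have hr : radiusAt ρ₂ s₂ (s₁ t) = ρ₂ u := by rw [← hut, h₂.radiusAt_angle]
      rw [hr]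
      push_cast
      ring_nf at h7 ⊢
      linarith
    have hcont : ∀ t ≥ 0, ContinuousAt δ t := by
      intro t ht
      obtain ⟨u, hu0, hut⟩ := hu t ht
      have h3 := h₂.continuousAt_radiusAt u
      rw [hut] at h3
      exact h₁.continuous_radius.continuousAt.sub (h3.comp h₁.continuous_angle.continuousAt)
    refine antitoneOn_of_deriv_nonpos (convex_Ici 0) ?_ ?_ ?_
    · intro t ht
      refine (((hcont t ht).pow 2).add ?_).continuousWithinAt
      exact (((hΦ (s₁ t)).continuousAt.comp h₁.continuous_angle.continuousAt).const_mul κ)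
    · rw [interior_Ici]
      intro t ht
      obtain ⟨f', _, hf⟩ := hD t ht
      exact hf.differentiableAt.differentiableWithinAt
    · rw [interior_Ici]
      intro t ht
      obtain ⟨f', hf', hf⟩ := hD t ht
      rwa [hf.deriv]
  have htop := ((tendsto_integral_sin_pow_atTop n).comp hs₁).const_mul_atTop hκp
  obtain ⟨t, ht, ht0⟩ := ((htop.eventually_gt_atTop (δ 0 ^ 2 +
      κ * ∫ u in (0 : ℝ)..s₁ 0, Real.sin u ^ (2 * n + 2))).and (eventually_ge_atTop 0)).exists
  have h8 := hmono self_mem_Ici ht0 ht0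
  simp only [Function.comp_apply] at ht h8
  nlinarith [sq_nonneg (δ t)]

end PolarCurve

/-! ### Existence of a periodic orbit -/

/-- The point with polar coordinates `exp ρ` and `s`, the angle being measured from the positive
`y`-axis towards the positive `x`-axis. -/
noncomputable def polarPoint (ρ s : ℝ) : ℝ × ℝ := (Real.exp ρ * Real.sin s, Real.exp ρ * Real.cos s)

/-- The angular momentum of the Liénard system: positive where solutions turn clockwise. -/
def angularMomentum (n : ℕ) (b : ℝ) (z : ℝ × ℝ) : ℝ :=
  z.1 ^ 2 + z.2 ^ 2 - z.2 * (b * (z.1 ^ (2 * n + 1) - z.1))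

theorem continuous_angularMomentum (n : ℕ) (b : ℝ) : Continuous (angularMomentum n b) := by
  unfold angularMomentum
  fun_prop

theorem polarPoint_sq_add_sq (ρ s : ℝ) :
    (polarPoint ρ s).1 ^ 2 + (polarPoint ρ s).2 ^ 2 = Real.exp ρ ^ 2 := by
  simp only [polarPoint]
  linear_combination Real.exp ρ ^ 2 * Real.sin_sq_add_cos_sq s

theorem IsForwardSolution.angularMomentum_pos {n : ℕ} {b : ℝ} (hb : 0 < b) {φ : ℝ → ℝ × ℝ}
    (hφ : IsForwardSolution (rayleighLienard n (-b)) φ) (h0 : 0 < angularMomentum n b (φ 0)) {t : ℝ}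
    (ht : 0 ≤ t) : 0 < angularMomentum n b (φ t) := by
  have := hφ.lienardCurve.rotation_pos hb (by simpa [angularMomentum] using h0) ht
  simpa [angularMomentum, max_eq_left ht] using this

theorem IsForwardSolution.exists_polarCurve {n : ℕ} {b : ℝ} (hb : 0 < b) {φ : ℝ → ℝ × ℝ}
    (hφ : IsForwardSolution (rayleighLienard n (-b)) φ) (hpos : 0 < angularMomentum n b (φ 0))
    {ρ₀ s₀ : ℝ} (h0 : φ 0 = polarPoint ρ₀ s₀) :
    ∃ ρ s : ℝ → ℝ, PolarCurve n b ρ s ∧ ρ 0 = ρ₀ ∧ s 0 = s₀ ∧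
      ∀ t ≥ 0, φ t = polarPoint (ρ t) (s t) := by
  obtain ⟨ρ, s, h, hρ, hs, hxy⟩ := hφ.lienardCurve.exists_polarCurve (ρ₀ := ρ₀) (s₀ := s₀)
    (fun t => hφ.angularMomentum_pos hb hpos (le_max_right t 0)) (by simp [h0, polarPoint])
    (by simp [h0, polarPoint])
  refine ⟨ρ, s, h, hρ, hs, fun t ht => ?_⟩
  have := hxy t ht
  rw [max_eq_left ht] at this
  exact Prod.ext this.1 this.2

/-- The half return from the positive to the negative `y`-axis. -/
theorem exists_half_return {n : ℕ} (hn : 0 < n) {b : ℝ} (hb : 0 < b) (ρ₀ : ℝ) (hρ₀ : 0 ≤ ρ₀) :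
    ∃ φ : ℝ → ℝ × ℝ, ∃ ρ s : ℝ → ℝ, ∃ T > 0, IsForwardSolution (rayleighLienard n (-b)) φ ∧
      PolarCurve n b ρ s ∧ ρ 0 = ρ₀ ∧ s 0 = 0 ∧ s T = Real.pi ∧
      (∀ t ≥ 0, φ t = polarPoint (ρ t) (s t)) ∧ ρ T ∈ Icc 0 (Real.log (barrierHeight b)) := by
  obtain ⟨φ, hφ, hφ0⟩ := rayleighLienard_exists_isForwardSolution n hb (polarPoint ρ₀ 0)
  obtain ⟨ρ, s, h, hρ0, hs0, hpt⟩ := hφ.exists_polarCurve hb (by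
    rw [hφ0]
    simp only [angularMomentum, polarPoint, Real.sin_zero, Real.cos_zero]
    simp [Real.exp_pos]) hφ0
  have hK := one_le_barrierHeight hb
  have hL := hφ.lienardCurve
  have hone : ∀ t ≥ 0, 0 ≤ ρ t := by
    intro t ht
    have h1 := hL.one_le_sq_add_sq hb (by
      simp only [max_self, hφ0, polarPoint_sq_add_sq]
      exact one_le_pow₀ (Real.one_le_exp hρ₀)) ht
    simp only [max_eq_left ht, hpt t ht, polarPoint_sq_add_sq] at h1
    by_contra! hneg
    have h2 := Real.exp_lt_exp.2 hneg
    rw [Real.exp_zero] at h2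
    have h3 := Real.exp_pos (ρ t)
    nlinarith
  have hmono := h.strictMono_angle.monotone
  have hfst : ∀ t ≥ 0, s t ≤ Real.pi → ∀ u ∈ Icc 0 t, 0 ≤ (φ (max u 0)).1 := by
    intro t ht hst u hu
    rw [max_eq_left hu.1, hpt u hu.1]
    exact mul_nonneg (Real.exp_pos _).le (Real.sin_nonneg_of_nonneg_of_le_pi
      (hs0 ▸ hmono hu.1) ((hmono hu.2).trans hst))
  have hlow : ∀ t ≥ 0, s t ≤ Real.pi → (φ t).1 - barrierHeight b ≤ (φ t).2 := by
    intro t ht hst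
    have := hL.sub_barrierHeight_le hn hb (by
      simp only [max_self, hφ0, polarPoint, Real.sin_zero, Real.cos_zero]
      have := Real.exp_pos ρ₀
      linarith) ht (hfst t ht hst)
    rwa [max_eq_left ht] at this
  have hup : ∀ t ≥ 0, s t ≤ Real.pi → (φ t).2 ≤ Real.exp ρ₀ := by
    intro t ht hst
    have := hL.snd_le ht (hfst t ht hst)
    simpa [max_eq_left ht, hφ0, polarPoint] using this
  -- Before angle `π` the solution is confined to `0 ≤ x`, `x - K ≤ y ≤ exp ρ₀`. Never reaching `π`
  -- would put it in an annulus, where the angle tends to infinity.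
  obtain ⟨t₁, ht₁, hst₁⟩ : ∃ t ≥ 0, Real.pi ≤ s t := by
    by_contra! hcon
    have hbd : ∀ t ≥ 0, ρ t ≤ Real.log (2 * (Real.exp ρ₀ + barrierHeight b)) := by
      intro t ht
      have h1 := hlow t ht (hcon t ht).le
      have h2 := hup t ht (hcon t ht).le
      have h3 := hfst t ht (hcon t ht).le t ⟨ht, le_rfl⟩
      rw [max_eq_left ht] at h3
      have h4 := polarPoint_sq_add_sq (ρ t) (s t)
      rw [← hpt t ht] at h4
      have h5 := Real.exp_pos ρ₀
      rw [← Real.log_exp (ρ t)]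
      refine Real.log_le_log (Real.exp_pos _) (abs_le_of_sq_le_sq' ?_ (by linarith)).2
      rw [← h4]
      have h6 : (φ t).1 ^ 2 ≤ (Real.exp ρ₀ + barrierHeight b) ^ 2 :=
        pow_le_pow_left₀ h3 (by linarith) 2
      have h7 : (φ t).2 ^ 2 ≤ (Real.exp ρ₀ + barrierHeight b) ^ 2 :=
        sq_le_sq' (by linarith) (by linarith)
      nlinarith
    obtain ⟨t, ht, ht0⟩ := (((h.tendsto_angle_atTop hb hone hbd).eventually_ge_atTop
      Real.pi).and (eventually_ge_atTop 0)).exists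
    exact absurd (hcon t ht0) (not_lt.2 ht)
  obtain ⟨T, hT, hsT⟩ := intermediate_value_Icc ht₁ h.continuous_angle.continuousOn
    (show Real.pi ∈ Icc (s 0) (s t₁) from ⟨hs0.trans_le Real.pi_pos.le, hst₁⟩)
  have hT0 : 0 < T := h.strictMono_angle.lt_iff_lt.1 (by rw [hs0, hsT]; exact Real.pi_pos)
  refine ⟨φ, ρ, s, T, hT0, hφ, h, hρ0, hs0, hsT, hpt, hone T hT0.le, ?_⟩
  -- At angle `π` one has `x = 0` and `y = -exp (ρ T)`, so the barrier bounds the radius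
  -- independently of `ρ₀`.
  have h1 := hlow T hT0.le hsT.le
  rw [hpt T hT0.le, hsT] at h1
  simp only [polarPoint, Real.sin_pi, Real.cos_pi] at h1
  rw [← Real.log_exp (ρ T)]
  exact Real.log_le_log (Real.exp_pos _) (by linarith)

/-- Half returns are nonexpansive in the logarithm of the radius. -/
theorem PolarCurve.abs_half_return_sub_le {n : ℕ} {b : ℝ} (hb : 0 < b) {ρ₁ s₁ ρ₂ s₂ : ℝ → ℝ}
    (h₁ : PolarCurve n b ρ₁ s₁) (h₂ : PolarCurve n b ρ₂ s₂) {T₁ T₂ α β : ℝ} (hT₁ : 0 ≤ T₁)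
    (hT₂ : 0 ≤ T₂) (hα₁ : s₁ 0 = α) (hα₂ : s₂ 0 = α) (hβ₁ : s₁ T₁ = β) (hβ₂ : s₂ T₂ = β) :
    |ρ₁ T₁ - ρ₂ T₂| ≤ |ρ₁ 0 - ρ₂ 0| := by
  have hu : ∀ t ∈ Icc 0 T₁, ∃ u, s₂ u = s₁ t := by
    intro t ht
    obtain ⟨u, _, hu⟩ := intermediate_value_Icc hT₂ h₂.continuous_angle.continuousOn
      (show s₁ t ∈ Icc (s₂ 0) (s₂ T₂) from
        ⟨hα₂ ▸ hα₁ ▸ h₁.strictMono_angle.monotone ht.1,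
          hβ₂ ▸ hβ₁ ▸ h₁.strictMono_angle.monotone ht.2⟩)
    exact ⟨u, hu⟩
  have := h₁.abs_radius_sub_antitoneOn h₂ hb (convex_Icc 0 T₁) Icc_subset_Ici_self hu (by
    rw [interior_Icc]
    intro t ht
    obtain ⟨u, hu⟩ := hu t (Ioo_subset_Icc_self ht)
    refine ⟨u, h₂.strictMono_angle.lt_iff_lt.1 ?_, hu⟩
    rw [hu, hα₂, ← hα₁]
    exact h₁.strictMono_angle ht.1) (left_mem_Icc.2 hT₁) (right_mem_Icc.2 hT₁) hT₁
  simp only at this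
  rwa [hα₁, hβ₁, ← hα₂, ← hβ₂, h₂.radiusAt_angle, h₂.radiusAt_angle] at this

/-! ### Time shifts, central symmetry and periodic extension -/

theorem IsForwardSolution.comp_add {X : ℝ × ℝ → ℝ × ℝ} {φ : ℝ → ℝ × ℝ}
    (hφ : IsForwardSolution X φ) {T : ℝ} (hT : 0 ≤ T) :
    IsForwardSolution X (fun t => φ (t + T)) := by
  intro t ht
  have h1 : HasDerivWithinAt (fun t => t + T) 1 (Ici 0) t := (hasDerivWithinAt_id t _).add_const T
  have h2 := HasDerivWithinAt.scomp t (hφ (t + T) (add_nonneg ht hT)) h1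
    (fun u hu => add_nonneg hu hT)
  simpa [Function.comp_def] using h2

theorem IsForwardSolution.neg {X : ℝ × ℝ → ℝ × ℝ} (hX : ∀ z, X (-z) = -X z) {φ : ℝ → ℝ × ℝ}
    (hφ : IsForwardSolution X φ) : IsForwardSolution X (fun t => -φ t) := by
  intro t ht
  have := (hφ t ht).neg
  simp only [hX]
  exact this

/-- A periodic forward solution extends to a periodic solution on the real line. -/
theorem IsForwardSolution.exists_periodic {X : ℝ × ℝ → ℝ × ℝ} {φ : ℝ → ℝ × ℝ}
    (hφ : IsForwardSolution X φ) {τ : ℝ} (hτ : 0 < τ) (hper : ∀ t ≥ 0, φ (t + τ) = φ t) :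
    ∃ Φ : ℝ → ℝ × ℝ, IsIntegralCurve Φ (fun _ => X) ∧ Function.Periodic Φ τ ∧
      EqOn Φ φ (Ici 0) := by
  have hnat : ∀ (k : ℕ), ∀ t ≥ 0, φ (t + k * τ) = φ t := by
    intro k
    induction k with
    | zero => simp
    | succ k ih =>
      intro t ht
      rw [show t + ((k + 1 : ℕ) : ℝ) * τ = t + k * τ + τ by push_cast; ring,
        hper _ (by positivity), ih t ht]
  set Φ : ℝ → ℝ × ℝ := fun t => φ (τ * Int.fract (t / τ)) with hΦ
  have hΦper : Function.Periodic Φ τ := fun t => by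
    simp only [hΦ, add_div, div_self hτ.ne', Int.fract_add_one]
  have heq : EqOn Φ φ (Ici 0) := fun t ht => by
    have h0 : (0 : ℝ) ≤ t / τ := div_nonneg ht hτ.le
    have h1 := hnat ⌊t / τ⌋₊ (τ * Int.fract (t / τ)) (mul_nonneg hτ.le (Int.fract_nonneg _))
    have h2 : τ * Int.fract (t / τ) + ⌊t / τ⌋₊ * τ = t := by
      rw [natCast_floor_eq_intCast_floor h0, Int.fract]
      field_simp
      ring
    rw [h2] at h1
    exact h1.symm
  refine ⟨Φ, fun t => ?_, hΦper, heq⟩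
  -- A shift by whole periods moves `t` to a positive time, where the derivative of `φ` is
  -- two-sided.
  obtain ⟨m, hm⟩ := exists_nat_gt (-t / τ)
  have hpos : 0 < t + m * τ := by
    rw [div_lt_iff₀ hτ] at hm
    linarith
  have hshift : ∀ u, Φ u = Φ (u + m * τ) := fun u => (hΦper.nat_mul m u).symm
  have h1 : HasDerivAt φ (X (φ (t + m * τ))) (t + m * τ) :=
    (hφ _ hpos.le).hasDerivAt (Ici_mem_nhds hpos)
  have h2 : HasDerivAt Φ (X (φ (t + m * τ))) (t + m * τ) :=
    h1.congr_of_eventuallyEq (heq.eventuallyEq_of_mem (Ici_mem_nhds hpos))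
  have h3 := h2.comp_add_const t (m * τ)
  rw [← heq hpos.le, ← hshift t] at h3
  exact h3.congr_of_eventuallyEq (Eventually.of_forall hshift)

/-- The Liénard system has a periodic orbit, which moreover rotates around the origin. -/
theorem exists_periodic_polarCurve {n : ℕ} (hn : 0 < n) {b : ℝ} (hb : 0 < b) :
    ∃ Φ : ℝ → ℝ × ℝ, ∃ τ > 0, ∃ ρ s : ℝ → ℝ,
      IsIntegralCurve Φ (fun _ => rayleighLienard n (-b)) ∧ Function.Periodic Φ τ ∧
      (∃ t u, Φ t ≠ Φ u) ∧ PolarCurve n b ρ s ∧ ∀ t ≥ 0, Φ t = polarPoint (ρ t) (s t) := by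
  choose! φ ρ s T hT hφ hP hρ0 hs0 hsT hpt hmem using exists_half_return hn hb
  have hlog : 0 ≤ Real.log (barrierHeight b) := Real.log_nonneg (one_le_barrierHeight hb)
  -- The comparison makes the half-return map 1-Lipschitz, so smooth dependence on initial data is
  -- not needed.
  have hcont : ContinuousOn (fun r => ρ r (T r)) (Icc 0 (Real.log (barrierHeight b))) := by
    refine LipschitzOnWith.continuousOn (K := 1) (LipschitzOnWith.of_dist_le_mul fun r hr r' hr' => ?_)
    rw [Real.dist_eq, Real.dist_eq, NNReal.coe_one, one_mul]
    have := (hP r hr.1).abs_half_return_sub_le hb (hP r' hr'.1) (hT r hr.1).le (hT r' hr'.1).le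
      (hs0 r hr.1) (hs0 r' hr'.1) (hsT r hr.1) (hsT r' hr'.1)
    rwa [hρ0 r hr.1, hρ0 r' hr'.1] at this
  obtain ⟨r, hr, hfix⟩ := exists_mem_Icc_isFixedPt_of_mapsTo hcont hlog
    (fun r hr => hmem r hr.1)
  have hr0 := hr.1
  have hTp := hT r hr0
  have hφ0 : φ r 0 = polarPoint r 0 := by rw [hpt r hr0 0 le_rfl, hρ0 r hr0, hs0 r hr0]
  have hφT : φ r (T r) = -φ r 0 := by
    rw [hφ0, hpt r hr0 _ hTp.le, hsT r hr0, show ρ r (T r) = r from hfix]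
    simp [polarPoint]
  have hhalf : ∀ t ≥ 0, φ r (t + T r) = -φ r t := by
    intro t ht
    have := IsForwardSolution.eqOn (contDiff_rayleighLienard n (-b))
      (((hφ r hr0).comp_add hTp.le).neg (rayleighLienard_neg_arg n (-b))) (hφ r hr0)
      (by simp [hφT]) ht
    exact neg_eq_iff_eq_neg.1 this
  obtain ⟨Φ, hΦ, hΦper, hΦφ⟩ := (hφ r hr0).exists_periodic (τ := T r + T r) (by linarith)
    (fun t ht => by rw [← add_assoc, hhalf _ (by positivity), hhalf t ht, neg_neg])
  refine ⟨Φ, T r + T r, by linarith, ρ r, s r, hΦ, hΦper, ⟨T r, 0, ?_⟩, hP r hr0, fun t ht => ?_⟩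
  · rw [hΦφ hTp.le, hΦφ self_mem_Ici, hφT, hφ0]
    intro h
    have h1 := congrArg Prod.snd h
    simp only [polarPoint, Prod.snd_neg, Real.cos_zero, mul_one] at h1
    linarith [Real.exp_pos r]
  · rw [hΦφ ht, hpt r hr0 t ht]

/-! ### Uniqueness and stability -/

/-- Under `(x, y) ↦ y + i x`, the angle measured from the `y`-axis is the complex argument. -/
theorem polarPoint_log_norm {z : ℝ × ℝ} (hz : z ≠ 0) {θ : ℝ}
    (hθ : (⟨z.2, z.1⟩ : ℂ) = ‖(⟨z.2, z.1⟩ : ℂ)‖ * Complex.exp (θ * Complex.I)) :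
    z = polarPoint (Real.log ‖(⟨z.2, z.1⟩ : ℂ)‖) θ := by
  have h0 : (⟨z.2, z.1⟩ : ℂ) ≠ 0 := fun h => hz <|
    Prod.ext (congrArg Complex.im h) (congrArg Complex.re h)
  have hre := congrArg Complex.re hθ
  have him := congrArg Complex.im hθ
  simp only [Complex.re_ofReal_mul, Complex.im_ofReal_mul, Complex.exp_ofReal_mul_I_re,
    Complex.exp_ofReal_mul_I_im] at hre him
  rw [polarPoint, Real.exp_log (norm_pos_iff.2 h0)]
  exact Prod.ext him hre

/-- Full turns push the angle past any `σ`; the comparison needs a start strictly beyond the initial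
angle of the reference curve. -/
theorem exists_eq_polarPoint {z : ℝ × ℝ} (hz : z ≠ 0) (σ : ℝ) :
    ∃ ρ s : ℝ, σ < s ∧ z = polarPoint ρ s := by
  obtain ⟨k, hk⟩ := exists_nat_gt ((σ - Complex.arg ⟨z.2, z.1⟩) / (2 * Real.pi))
  have hπ : (0 : ℝ) < 2 * Real.pi := by positivity
  rw [div_lt_iff₀ hπ] at hk
  refine ⟨Real.log ‖(⟨z.2, z.1⟩ : ℂ)‖, Complex.arg ⟨z.2, z.1⟩ + k * (2 * Real.pi), by linarith, ?_⟩
  have h1 := polarPoint_log_norm hz (θ := Complex.arg ⟨z.2, z.1⟩)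
    (Complex.norm_mul_exp_arg_mul_I _).symm
  rw [polarPoint, Real.sin_add_nat_mul_two_pi, Real.cos_add_nat_mul_two_pi]
  exact h1

/-- Polar coordinates can be chosen continuously near a point. -/
theorem exists_local_polarPoint {ρ₀ s₀ : ℝ} :
    ∃ r θ : ℝ × ℝ → ℝ, ContinuousAt r (polarPoint ρ₀ s₀) ∧ ContinuousAt θ (polarPoint ρ₀ s₀) ∧
      r (polarPoint ρ₀ s₀) = ρ₀ ∧ θ (polarPoint ρ₀ s₀) = s₀ ∧
      ∀ z ≠ 0, z = polarPoint (r z) (θ z) := by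
  have hq : (⟨(polarPoint ρ₀ s₀).2, (polarPoint ρ₀ s₀).1⟩ : ℂ) =
      Real.exp ρ₀ * Complex.exp (s₀ * Complex.I) := by
    apply Complex.ext <;>
      simp only [polarPoint, Complex.re_ofReal_mul, Complex.im_ofReal_mul,
        Complex.exp_ofReal_mul_I_re, Complex.exp_ofReal_mul_I_im]
  set Q : ℂ := Real.exp ρ₀ * Complex.exp (s₀ * Complex.I) with hQ
  have hQn : ‖Q‖ = Real.exp ρ₀ := by
    rw [hQ, norm_mul, Complex.norm_exp_ofReal_mul_I, mul_one, Complex.norm_real,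
      Real.norm_of_nonneg (Real.exp_pos _).le]
  have hQ0 : Q ≠ 0 := norm_pos_iff.1 (hQn ▸ Real.exp_pos _)
  have hQ' : (‖Q‖ : ℂ) * Complex.exp (s₀ * Complex.I) = Q := by rw [hQn]
  have hc : Continuous fun z : ℝ × ℝ => (⟨z.2, z.1⟩ : ℂ) := by
    have : (fun z : ℝ × ℝ => (⟨z.2, z.1⟩ : ℂ)) =
        fun z : ℝ × ℝ => (z.2 : ℂ) + z.1 * Complex.I := by
      ext z
      exact Complex.mk_eq_add_mul_I _ _
    rw [this]
    fun_prop
  -- Division by `Q` moves the base point to `1`, in the slit plane where `arg` is continuous.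
  refine ⟨fun z => Real.log ‖(⟨z.2, z.1⟩ : ℂ)‖, fun z => s₀ + Complex.arg (⟨z.2, z.1⟩ / Q),
    ?_, ?_, ?_, ?_, fun z hz => polarPoint_log_norm hz ?_⟩
  · refine ContinuousAt.log hc.norm.continuousAt ?_
    rw [hq]
    exact norm_ne_zero_iff.2 hQ0
  · refine continuousAt_const.add (ContinuousAt.comp (g := Complex.arg)
      (f := fun z : ℝ × ℝ => (⟨z.2, z.1⟩ : ℂ) / Q) (Complex.continuousAt_arg ?_)
      (hc.div_const Q).continuousAt)
    rw [hq, div_self hQ0]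
    exact Complex.one_mem_slitPlane
  · simp only [hq, hQn, Real.log_exp]
  · simp only [hq, div_self hQ0, Complex.arg_one, add_zero]
  · have h1 := Complex.norm_mul_exp_arg_mul_I (⟨z.2, z.1⟩ / Q)
    rw [norm_div, Complex.ofReal_div] at h1
    have hQn0 : (‖Q‖ : ℂ) ≠ 0 := by exact_mod_cast norm_ne_zero_iff.2 hQ0
    rw [Complex.ofReal_add, add_mul, Complex.exp_add]
    calc (⟨z.2, z.1⟩ : ℂ) = Q * (⟨z.2, z.1⟩ / Q) := by field_simp
      _ = ((‖Q‖ : ℂ) * Complex.exp (s₀ * Complex.I)) * ((‖(⟨z.2, z.1⟩ : ℂ)‖ : ℂ) / ‖Q‖ *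
          Complex.exp ((Complex.arg (⟨z.2, z.1⟩ / Q) : ℝ) * Complex.I)) := by rw [h1, hQ']
      _ = _ := by field_simp

theorem smul_polarPoint (η ρ s : ℝ) : Real.exp η • polarPoint ρ s = polarPoint (ρ + η) s := by
  simp only [polarPoint, Prod.smul_mk, smul_eq_mul, Real.exp_add]
  ext <;> simp <;> ring

theorem dist_polarPoint_le (ρ ρ' s : ℝ) :
    dist (polarPoint ρ s) (polarPoint ρ' s) ≤ Real.exp ρ' * |Real.exp (ρ - ρ') - 1| := by
  have e : Real.exp ρ = Real.exp ρ' * Real.exp (ρ - ρ') := by rw [← Real.exp_add]; ring_nf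
  have key : ∀ w : ℝ, |w| ≤ 1 → dist (Real.exp ρ * w) (Real.exp ρ' * w) ≤
      Real.exp ρ' * |Real.exp (ρ - ρ') - 1| := fun w hw => by
    rw [Real.dist_eq, ← sub_mul, e, ← mul_sub_one, abs_mul, abs_mul, abs_of_pos (Real.exp_pos ρ')]
    exact mul_le_of_le_one_right (by positivity) hw
  exact max_le (key _ (Real.abs_sin_le_one s)) (key _ (Real.abs_cos_le_one s))

theorem ne_zero_of_angularMomentum_pos {n : ℕ} {b : ℝ} {z : ℝ × ℝ}
    (h : 0 < angularMomentum n b z) : z ≠ 0 := by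
  rintro rfl
  simp [angularMomentum] at h

theorem IsIntegralCurve.isForwardSolution {X : ℝ × ℝ → ℝ × ℝ} {φ : ℝ → ℝ × ℝ}
    (h : IsIntegralCurve φ (fun _ => X)) : IsForwardSolution X φ :=
  h.isIntegralCurveOn _

/-- A nonconstant periodic solution of the Liénard system rotates around the origin. -/
theorem angularMomentum_pos_of_periodic {n : ℕ} {b : ℝ} (hb : 0 < b) {φ : ℝ → ℝ × ℝ}
    (hφ : IsIntegralCurve φ (fun _ => rayleighLienard n (-b))) {τ : ℝ} (hτ : 0 < τ)
    (hper : Function.Periodic φ τ) (hne : ∃ t u, φ t ≠ φ u) (t : ℝ) :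
    0 < angularMomentum n b (φ t) := by
  have hfwd := hφ.isForwardSolution
  have hback : ∀ t₀ u : ℝ, ∃ v ≥ 0, φ u = φ (v + t₀) := by
    intro t₀ u
    obtain ⟨m, hm⟩ := exists_nat_gt ((t₀ - u) / τ)
    rw [div_lt_iff₀ hτ] at hm
    refine ⟨u + m * τ - t₀, by linarith, ?_⟩
    rw [sub_add_cancel]
    exact (hper.nat_mul m u).symm
  have hshift : ∀ t₀, IsForwardSolution (rayleighLienard n (-b)) (fun t => φ (t + t₀)) :=
    fun t₀ t _ => ((hφ (t + t₀)).comp_add_const t t₀).hasDerivWithinAt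
  have hX0 : rayleighLienard n (-b) 0 = 0 := by simp [rayleighLienard]
  have hnz : ∀ t₀, φ t₀ ≠ 0 := by
    intro t₀ h0
    have hz : IsForwardSolution (rayleighLienard n (-b)) (fun _ => 0) := fun t _ => by
      simpa [hX0] using hasDerivWithinAt_const (c := (0 : ℝ × ℝ)) (s := Ici 0) (x := t)
    have heq := IsForwardSolution.eqOn (contDiff_rayleighLienard n (-b)) (hshift t₀) hz
      (by simpa using h0)
    have hall : ∀ u, φ u = 0 := fun u => by
      obtain ⟨v, hv, huv⟩ := hback t₀ u
      rw [huv]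
      exact heq hv
    obtain ⟨t, u, htu⟩ := hne
    exact htu ((hall t).trans (hall u).symm)
  have hy : ∀ t, HasDerivAt (fun t => (φ t).2) (-(φ t).1) t := fun t => by
    have := (hφ t).hasFDerivAt.snd.hasDerivAt
    simpa [rayleighLienard] using this
  have hxc : Continuous fun t => (φ t).1 := hφ.continuous.fst
  -- If `x` never vanished, `y' = -x` would make `y` strictly monotone, contradicting periodicity.
  -- On the axis the angular momentum is `y² > 0`.
  obtain ⟨t₀, ht₀⟩ : ∃ t₀, (φ t₀).1 = 0 := by
    by_contra! hcon
    have hyper : (φ τ).2 = (φ 0).2 := by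
      have := hper 0
      rw [zero_add] at this
      rw [this]
    have hsign : (∀ t, 0 < (φ t).1) ∨ ∀ t, (φ t).1 < 0 := by
      by_contra! hmix
      obtain ⟨⟨u, hu⟩, v, hv⟩ := hmix
      obtain ⟨w, hw⟩ := mem_range_of_exists_le_of_exists_ge hxc ⟨u, hu⟩ ⟨v, hv⟩
      exact hcon w hw
    rcases hsign with h | h
    · have : StrictAnti fun t => (φ t).2 := strictAnti_of_deriv_neg fun t => by
        rw [(hy t).deriv]
        linarith [h t]
      exact absurd hyper (this hτ).ne
    · have : StrictMono fun t => (φ t).2 := strictMono_of_deriv_pos fun t => by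
        rw [(hy t).deriv]
        linarith [h t]
      exact absurd hyper (this hτ).ne'
  obtain ⟨v, hv, htv⟩ := hback t₀ t
  rw [htv]
  refine (hshift t₀).angularMomentum_pos hb ?_ hv
  have h2 : (φ t₀).2 ≠ 0 := fun h => hnz t₀ (Prod.ext ht₀ h)
  simp only [zero_add, angularMomentum, ht₀]
  have : 0 < (φ t₀).2 ^ 2 := by positivity
  simpa using this

/-- The system has exactly one periodic orbit, and this orbit is stable. -/
theorem exists_unique_stable_periodicOrbit {n : ℕ} (hn : 0 < n) {b : ℝ} (hb : 0 < b) :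
    ∃ γ, IsPeriodicOrbit (rayleighLienard n (-b)) γ ∧
      (∀ γ', IsPeriodicOrbit (rayleighLienard n (-b)) γ' → γ' = γ) ∧
      IsStableCycle (rayleighLienard n (-b)) γ := by
  obtain ⟨Φ, τ, hτ, ρ, s, hΦ, hper, hne, hP, hpt⟩ := exists_periodic_polarCurve hn hb
  have hX := contDiff_rayleighLienard n (-b)
  have hΦc : Continuous Φ := hΦ.continuous
  have hcomp : IsCompact (range Φ) := hper.compact_of_continuous hτ.ne' hΦc
  have hmom : ∀ t, 0 < angularMomentum n b (Φ t) := angularMomentum_pos_of_periodic hb hΦ hτ hper hne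
  obtain ⟨A, B, hAB⟩ : ∃ A B, ∀ t ≥ 0, A ≤ ρ t ∧ ρ t ≤ B := by
    obtain ⟨B, hB⟩ := isCompact_Icc.bddAbove_image
      (hP.continuous_radius.continuousOn (s := Icc 0 τ))
    obtain ⟨A, hA⟩ := isCompact_Icc.bddBelow_image
      (hP.continuous_radius.continuousOn (s := Icc 0 τ))
    refine ⟨A, B, fun t ht => ?_⟩
    obtain ⟨u, hu, htu⟩ := hper.exists_mem_Ico₀ hτ t
    have h1 := polarPoint_sq_add_sq (ρ t) (s t)
    rw [← hpt t ht, htu, hpt u hu.1, polarPoint_sq_add_sq] at h1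
    have h2 : ρ t = ρ u := Real.exp_injective
      ((pow_left_inj₀ (Real.exp_pos _).le (Real.exp_pos _).le two_ne_zero).1 h1).symm
    rw [h2]
    exact ⟨hA ⟨u, Ico_subset_Icc_self hu, rfl⟩, hB ⟨u, Ico_subset_Icc_self hu, rfl⟩⟩
  have hs := hP.tendsto_angle_atTop hb (fun t ht => (hAB t ht).1) (fun t ht => (hAB t ht).2)
  have hattr : ∀ ψ, IsForwardSolution (rayleighLienard n (-b)) ψ →
      0 < angularMomentum n b (ψ 0) →
      Tendsto (fun t => Metric.infDist (ψ t) (range Φ)) atTop (𝓝 0) := by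
    intro ψ hψ hψ0
    obtain ⟨ρ₀, s₀, hs₀, h0⟩ := exists_eq_polarPoint (ne_zero_of_angularMomentum_pos hψ0) (s 0)
    obtain ⟨ρ₁, s₁, hP₁, hρ₁, hs₁, hpt₁⟩ := hψ.exists_polarCurve hb hψ0 h0
    rw [← hs₁] at hs₀
    have hlim := hP₁.tendsto_radius_sub hP hn hb (fun t ht => (hAB t ht).1)
      (fun t ht => (hAB t ht).2) hs₀
    have hlim2 : Tendsto (fun t => Real.exp B *
        |Real.exp (ρ₁ t - radiusAt ρ s (s₁ t)) - 1|) atTop (𝓝 0) := by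
      have := (((Real.continuous_exp.tendsto 0).comp hlim).sub_const 1).abs.const_mul (Real.exp B)
      simpa using this
    refine squeeze_zero' (Eventually.of_forall fun t => Metric.infDist_nonneg) ?_ hlim2
    filter_upwards [eventually_ge_atTop 0] with t ht
    obtain ⟨u, hu0, hu⟩ := hP₁.exists_angle_eq_of_lt hP hs hs₀ ht
    refine (Metric.infDist_le_dist_of_mem (mem_range_self u)).trans ?_
    rw [hpt₁ t ht, hpt u hu0.le, hu]
    refine (dist_polarPoint_le _ _ _).trans ?_
    rw [← hu, hP.radiusAt_angle]
    have := Real.exp_le_exp.2 (hAB u hu0.le).2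
    gcongr
  refine ⟨range Φ, ⟨Φ, hΦ, ⟨τ, hτ, hper⟩, hne, rfl⟩, ?_, ?_, ?_⟩
  · rintro γ' ⟨ψ, hψ, ⟨τ', hτ', hper'⟩, hne', rfl⟩
    have hmom' := angularMomentum_pos_of_periodic hb hψ hτ' hper' hne'
    have hlim := hattr ψ hψ.isForwardSolution (hmom' 0)
    -- The distance to `range Φ` is the same at all multiples of `τ'` and tends to `0`, so it
    -- vanishes.
    have hmem : ψ 0 ∈ range Φ := by
      rw [hcomp.isClosed.mem_iff_infDist_zero (range_nonempty Φ)]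
      have h1 : Tendsto (fun k : ℕ => Metric.infDist (ψ (k * τ')) (range Φ)) atTop (𝓝 0) :=
        hlim.comp (tendsto_natCast_atTop_atTop.atTop_mul_const hτ')
      refine tendsto_nhds_unique (tendsto_const_nhds.congr fun k => ?_) h1
      have := hper'.nat_mul k 0
      rw [zero_add] at this
      rw [this]
    obtain ⟨t₀, ht₀⟩ := hmem
    have hshift : IsForwardSolution (rayleighLienard n (-b)) (fun t => Φ (t + t₀)) :=
      fun t _ => ((hΦ (t + t₀)).comp_add_const t t₀).hasDerivWithinAt
    have heq := IsForwardSolution.eqOn hX hshift hψ.isForwardSolution (by simpa using ht₀)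
    apply Subset.antisymm
    · rintro _ ⟨t, rfl⟩
      obtain ⟨u, hu, htu⟩ := hper'.exists_mem_Ico₀ hτ' t
      rw [htu, ← heq hu.1]
      exact mem_range_self _
    · rintro _ ⟨t, rfl⟩
      obtain ⟨u, hu, htu⟩ := hper.exists_mem_Ico hτ t t₀
      have := heq (x := u - t₀) (sub_nonneg.2 hu.1)
      simp only [sub_add_cancel] at this
      rw [htu, this]
      exact mem_range_self _
  · intro U hU hγU
    obtain ⟨ε, hε, hεU⟩ : ∃ ε > 0, ∀ η : ℝ, |η| < ε → ∀ q ∈ range Φ, Real.exp η • q ∈ U := by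
      have hcont : Continuous fun w : ℝ × (ℝ × ℝ) => Real.exp w.1 • w.2 := by fun_prop
      obtain ⟨u, v, hu, -, h0u, hγv, huv⟩ := generalized_tube_lemma
        (isCompact_singleton (x := (0 : ℝ))) hcomp (hU.preimage hcont) (by
          rintro ⟨η, q⟩ ⟨hη, hq⟩
          rw [mem_singleton_iff] at hη
          simp only at hη hq
          subst hη
          simpa using hγU hq)
      obtain ⟨ε, hε, hball⟩ := Metric.isOpen_iff.1 hu 0 (h0u rfl)
      refine ⟨ε, hε, fun η hη q hq => huv (show (η, q) ∈ u ×ˢ v from ⟨hball ?_, hγv hq⟩)⟩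
      simpa using hη
    -- A tube of radial dilations of the orbit. Taking `t > 0` leaves room for nearby angles and
    -- makes the starting angle exceed `s 0`; the gap `|η|` never grows afterwards.
    set V : Set (ℝ × ℝ) := {z | 0 < angularMomentum n b z ∧
      ∃ t > 0, ∃ η, |η| < ε ∧ z = polarPoint (ρ t + η) (s t)} with hV
    refine ⟨interior V, isOpen_interior, ?_, ?_⟩
    · rintro _ ⟨t', rfl⟩
      obtain ⟨t, ht, htt⟩ := hper.exists_mem_Ioc hτ t' 0
      rw [htt, mem_interior_iff_mem_nhds, hV]
      have hmt := hmom t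
      rw [hpt t ht.1.le] at hmt ⊢
      obtain ⟨r, θ, hr, hθ, hr0, hθ0, hrθ⟩ := exists_local_polarPoint (ρ₀ := ρ t) (s₀ := s t)
      have hopen := (continuous_angularMomentum n b).continuousAt.eventually (lt_mem_nhds hmt)
      have hcont : ContinuousAt (fun z => |r z - radiusAt ρ s (θ z)|) (polarPoint (ρ t) (s t)) := by
        refine (hr.sub (ContinuousAt.comp (g := radiusAt ρ s) ?_ hθ)).abs
        rw [hθ0]
        exact hP.continuousAt_radiusAt t
      have hclose := hcont.eventually (gt_mem_nhds (show _ < ε by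
        simpa [hr0, hθ0, hP.radiusAt_angle] using hε))
      have hlarge := hθ.eventually (lt_mem_nhds (show s 0 < θ (polarPoint (ρ t) (s t)) by
        rw [hθ0]
        exact hP.strictMono_angle ht.1))
      filter_upwards [hopen, hclose, hlarge] with z hz1 hz2 hz3
      obtain ⟨u, hu0, hu⟩ := hP.exists_angle_eq hs hz3
      refine ⟨hz1, u, hu0, r z - ρ u, ?_, ?_⟩
      · rwa [← hu, hP.radiusAt_angle] at hz2
      · rw [add_sub_cancel, hu]
        exact hrθ z (ne_zero_of_angularMomentum_pos hz1)
    · intro ψ hψ hψV t ht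
      obtain ⟨hψ0, t₀, ht₀, η, hη, h0⟩ := interior_subset hψV
      obtain ⟨ρ₁, s₁, hP₁, hρ₁, hs₁, hpt₁⟩ := hψ.exists_polarCurve hb hψ0 h0
      have hs₀ : s 0 < s₁ 0 := hs₁ ▸ hP.strictMono_angle ht₀
      have hle := hP₁.abs_radius_sub_antitoneOn_Ici hP hb hs hs₀ self_mem_Ici ht ht
      simp only [hρ₁, hs₁, hP.radiusAt_angle, add_sub_cancel_left] at hle
      obtain ⟨u, hu0, hu⟩ := hP₁.exists_angle_eq_of_lt hP hs hs₀ ht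
      rw [← hu, hP.radiusAt_angle] at hle
      have := hεU (ρ₁ t - ρ u) (hle.trans_lt hη) (Φ u) (mem_range_self u)
      rwa [hpt u hu0.le, smul_polarPoint, add_sub_cancel, hu, ← hpt₁ t ht] at this
  · exact ⟨{z | 0 < angularMomentum n b z},
      isOpen_lt continuous_const (continuous_angularMomentum n b),
      by rintro _ ⟨t, rfl⟩; exact hmom t,
      fun p _ => rayleighLienard_exists_isForwardSolution n hb p, hattr⟩

/-! ### Transfer to linearly equivalent systems -/

theorem LinearIsometryEquiv.symm_conj_of_conj {X Y : ℝ × ℝ → ℝ × ℝ}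
    {A : (ℝ × ℝ) ≃ₗᵢ[ℝ] (ℝ × ℝ)} (hA : ∀ z, Y (A z) = A (X z)) (z : ℝ × ℝ) :
    X (A.symm z) = A.symm (Y z) := by
  rw [← A.symm_apply_apply (X (A.symm z)), ← hA, A.apply_symm_apply]

theorem IsIntegralCurveOn.map_linearIsometryEquiv {X Y : ℝ × ℝ → ℝ × ℝ}
    {A : (ℝ × ℝ) ≃ₗᵢ[ℝ] (ℝ × ℝ)} (hA : ∀ z, Y (A z) = A (X z)) {φ : ℝ → ℝ × ℝ} {s : Set ℝ}
    (hφ : IsIntegralCurveOn φ (fun _ => X) s) :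
    IsIntegralCurveOn (fun t => A (φ t)) (fun _ => Y) s := fun t ht => by
  simp only [hA]
  exact A.toContinuousLinearEquiv.toContinuousLinearMap.hasFDerivAt.comp_hasDerivWithinAt t (hφ t ht)

theorem IsPeriodicOrbit.image_linearIsometryEquiv {X Y : ℝ × ℝ → ℝ × ℝ}
    {A : (ℝ × ℝ) ≃ₗᵢ[ℝ] (ℝ × ℝ)} (hA : ∀ z, Y (A z) = A (X z)) {γ : Set (ℝ × ℝ)}
    (hγ : IsPeriodicOrbit X γ) : IsPeriodicOrbit Y (A '' γ) := by
  obtain ⟨φ, hφ, ⟨τ, hτ, hper⟩, ⟨t, u, hne⟩, rfl⟩ := hγ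
  refine ⟨fun t => A (φ t), ?_, ⟨τ, hτ, fun t => congrArg A (hper t)⟩,
    ⟨t, u, A.injective.ne hne⟩, range_comp A φ⟩
  rw [← isIntegralCurveOn_univ] at hφ ⊢
  exact hφ.map_linearIsometryEquiv hA

theorem IsStableCycle.image_linearIsometryEquiv {X Y : ℝ × ℝ → ℝ × ℝ}
    {A : (ℝ × ℝ) ≃ₗᵢ[ℝ] (ℝ × ℝ)} (hA : ∀ z, Y (A z) = A (X z)) {γ : Set (ℝ × ℝ)}
    (hγ : IsStableCycle X γ) : IsStableCycle Y (A '' γ) := by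
  have hback : ∀ {φ}, IsForwardSolution Y φ → IsForwardSolution X (fun t => A.symm (φ t)) :=
    fun hφ => IsIntegralCurveOn.map_linearIsometryEquiv
      (LinearIsometryEquiv.symm_conj_of_conj hA) hφ
  have hsub : ∀ {V : Set (ℝ × ℝ)}, γ ⊆ V → A '' γ ⊆ A.symm ⁻¹' V := by
    rintro V hV _ ⟨z, hz, rfl⟩
    simpa using hV hz
  constructor
  · intro U hU hγU
    obtain ⟨V, hV, hγV, h⟩ := hγ.stays_near (A ⁻¹' U) (hU.preimage A.continuous)
      (image_subset_iff.1 hγU)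
    refine ⟨A.symm ⁻¹' V, hV.preimage A.symm.continuous, hsub hγV, fun φ hφ h0 t ht => ?_⟩
    simpa using h _ (hback hφ) h0 t ht
  · obtain ⟨W, hW, hγW, hex, hlim⟩ := hγ.attracts
    refine ⟨A.symm ⁻¹' W, hW.preimage A.symm.continuous, hsub hγW, fun p hp => ?_,
      fun φ hφ h0 => ?_⟩
    · obtain ⟨φ, hφ, h0⟩ := hex _ hp
      exact ⟨fun t => A (φ t), hφ.map_linearIsometryEquiv hA, by simp [h0]⟩
    · refine (hlim _ (hback hφ) h0).congr fun t => ?_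
      rw [← Metric.infDist_image A.isometry, A.apply_symm_apply]

theorem IsPeriodicOrbit.neg {X : ℝ × ℝ → ℝ × ℝ} {γ : Set (ℝ × ℝ)} (hγ : IsPeriodicOrbit X γ) :
    IsPeriodicOrbit (fun z => -X z) γ := by
  obtain ⟨φ, hφ, ⟨τ, hτ, hper⟩, ⟨t, u, hne⟩, rfl⟩ := hγ
  refine ⟨fun t => φ (-t), fun t => ?_, ⟨τ, hτ, fun t => ?_⟩, ⟨-t, -u, by simpa using hne⟩, ?_⟩
  · have := (hφ (-t)).scomp t (hasDerivAt_neg t)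
    simpa [Function.comp_def] using this
  · have := hper.sub_eq (-t)
    rwa [sub_eq_add_neg, ← neg_add] at this
  · exact (Equiv.neg ℝ).surjective.range_comp φ

/-- A planar field with a single periodic orbit has that orbit as its only limit cycle. -/
theorem existsUnique_isLimitCycle {X : ℝ × ℝ → ℝ × ℝ} {P : Set (ℝ × ℝ) → Prop}
    (h : ∃ γ, IsPeriodicOrbit X γ ∧ (∀ γ', IsPeriodicOrbit X γ' → γ' = γ) ∧ P γ) :
    (∃! γ, IsLimitCycle X γ) ∧ ∀ γ, IsLimitCycle X γ → P γ := by
  obtain ⟨γ, hγ, huniq, hP⟩ := h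
  refine ⟨⟨γ, ⟨hγ, univ, isOpen_univ, subset_univ _, fun γ' _ h' => huniq γ' h'⟩,
    fun γ' h' => huniq γ' h'.1⟩, fun γ' h' => ?_⟩
  rwa [huniq γ' h'.1]

theorem exists_unique_stable_of_conj {X Y : ℝ × ℝ → ℝ × ℝ} {A : (ℝ × ℝ) ≃ₗᵢ[ℝ] (ℝ × ℝ)}
    (hA : ∀ z, Y (A z) = A (X z))
    (h : ∃ γ, IsPeriodicOrbit X γ ∧ (∀ γ', IsPeriodicOrbit X γ' → γ' = γ) ∧ IsStableCycle X γ) :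
    ∃ γ, IsPeriodicOrbit Y γ ∧ (∀ γ', IsPeriodicOrbit Y γ' → γ' = γ) ∧ IsStableCycle Y γ := by
  obtain ⟨γ, hγ, huniq, hs⟩ := h
  refine ⟨A '' γ, hγ.image_linearIsometryEquiv hA, fun γ' h' => ?_, hs.image_linearIsometryEquiv hA⟩
  rw [← huniq _ (h'.image_linearIsometryEquiv (LinearIsometryEquiv.symm_conj_of_conj hA)),
    ← image_comp]
  simp

theorem exists_unique_unstable_of_reversed {X : ℝ × ℝ → ℝ × ℝ}
    (h : ∃ γ, IsPeriodicOrbit (fun z => -X z) γ ∧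
      (∀ γ', IsPeriodicOrbit (fun z => -X z) γ' → γ' = γ) ∧ IsStableCycle (fun z => -X z) γ) :
    ∃ γ, IsPeriodicOrbit X γ ∧ (∀ γ', IsPeriodicOrbit X γ' → γ' = γ) ∧ IsUnstableCycle X γ := by
  obtain ⟨γ, hγ, huniq, hs⟩ := h
  exact ⟨γ, by simpa using hγ.neg, fun γ' h' => huniq γ' h'.neg, hs⟩

/-- The linear isometry of the plane that swaps the coordinates. -/
def swapIsometry : (ℝ × ℝ) ≃ₗᵢ[ℝ] (ℝ × ℝ) where
  toLinearEquiv := LinearEquiv.prodComm ℝ ℝ ℝ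
  norm_map' z := by simp [Prod.norm_def, max_comm]

/-- The reflection of the plane in the first coordinate axis. -/
def reflectIsometry : (ℝ × ℝ) ≃ₗᵢ[ℝ] (ℝ × ℝ) where
  toLinearEquiv := (LinearEquiv.refl ℝ ℝ).prodCongr (LinearEquiv.neg ℝ)
  norm_map' z := by simp [Prod.norm_def]

@[simp] theorem swapIsometry_apply (z : ℝ × ℝ) : swapIsometry z = (z.2, z.1) := rfl

@[simp] theorem reflectIsometry_apply (z : ℝ × ℝ) : reflectIsometry z = (z.1, -z.2) := rfl

theorem isLinearCenter_rotation : IsLinearCenter (fun z : ℝ × ℝ => (z.2, -z.1)) := by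
  refine ⟨⟨fun u v => ?_, fun c u => ?_⟩, by simp, univ, isOpen_univ, mem_univ _, fun q hq => ?_⟩
  · ext <;> simp
    ring
  · ext <;> simp
  have hq0 : q ≠ 0 := hq.2
  set φ : ℝ → ℝ × ℝ := fun t =>
    (q.1 * Real.cos t + q.2 * Real.sin t, q.2 * Real.cos t - q.1 * Real.sin t) with hφ
  have hnorm : ∀ t, (φ t).1 ^ 2 + (φ t).2 ^ 2 = q.1 ^ 2 + q.2 ^ 2 := fun t => by
    simp only [hφ]
    linear_combination (q.1 ^ 2 + q.2 ^ 2) * Real.sin_sq_add_cos_sq t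
  have h0 : φ 0 = q := by simp [hφ]
  refine ⟨range φ, ?_, ⟨φ, fun t => ?_, ⟨2 * Real.pi, by positivity, fun t => by simp [hφ]⟩,
    ⟨0, Real.pi, ?_⟩, rfl⟩, ⟨0, h0⟩⟩
  · rintro _ ⟨t, rfl⟩
    refine ⟨mem_univ _, fun h => hq0 ?_⟩
    have h1 := hnorm t
    rw [mem_singleton_iff] at h
    simp only [h, Prod.fst_zero, Prod.snd_zero] at h1
    exact Prod.ext (by simp; nlinarith [sq_nonneg q.1, sq_nonneg q.2])
      (by simp; nlinarith [sq_nonneg q.1, sq_nonneg q.2])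
  · have hs := Real.hasDerivAt_sin t
    have hc := Real.hasDerivAt_cos t
    refine (((hc.const_mul q.1).add (hs.const_mul q.2)).prodMk
      ((hc.const_mul q.2).sub (hs.const_mul q.1))).congr_deriv ?_
    simp only [hφ, Prod.mk.injEq]
    constructor <;> ring
  · rw [h0]
    intro h
    have h1 := congrArg Prod.fst h
    have h2 := congrArg Prod.snd h
    simp only [hφ, Real.cos_pi, Real.sin_pi] at h1 h2
    exact hq0 (Prod.ext (by simp; linarith) (by simp; linarith))

/-- The isometry is the quarter turn `(x, y) ↦ (-y, x)`, which keeps the direction of time; the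
other two conjugacies reverse it. -/
theorem rayleigh_conj (n : ℕ) (a : ℝ) (z : ℝ × ℝ) :
    rayleigh n a ((swapIsometry.trans reflectIsometry).trans (LinearIsometryEquiv.neg ℝ) z) =
      (swapIsometry.trans reflectIsometry).trans (LinearIsometryEquiv.neg ℝ)
        (rayleighLienard n (-a) z) := by
  simp only [LinearIsometryEquiv.coe_trans, Function.comp_apply, swapIsometry_apply,
    reflectIsometry_apply, LinearIsometryEquiv.coe_neg, rayleigh, rayleighLienard]
  ext <;> simp
  ring

theorem rayleigh_reversed_conj (n : ℕ) (a : ℝ) (z : ℝ × ℝ) :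
    -rayleigh n a (swapIsometry z) = swapIsometry (rayleighLienard n a z) := by
  simp only [swapIsometry_apply, rayleigh, rayleighLienard]
  ext <;> simp
  ring

theorem rayleighLienard_reversed_conj (n : ℕ) (a : ℝ) (z : ℝ × ℝ) :
    -rayleighLienard n a (reflectIsometry z) = reflectIsometry (rayleighLienard n (-a) z) := by
  simp only [reflectIsometry_apply, rayleighLienard]
  ext <;> simp
  ring

theorem theorem1 (n : ℕ) (hn : 0 < n) (a : ℝ) :
    -- the generalized Rayleigh system
    ((a ≠ 0 → ∃! γ : Set (ℝ × ℝ), IsLimitCycle (rayleigh n a) γ) ∧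
      (∀ γ : Set (ℝ × ℝ), IsLimitCycle (rayleigh n a) γ →
        (0 < a → IsStableCycle (rayleigh n a) γ) ∧
        (a < 0 → IsUnstableCycle (rayleigh n a) γ)) ∧
      (a = 0 → IsLinearCenter (rayleigh n a))) ∧
    -- its time-reversed Liénard form
    ((a ≠ 0 → ∃! γ : Set (ℝ × ℝ), IsLimitCycle (rayleighLienard n a) γ) ∧
      (∀ γ : Set (ℝ × ℝ), IsLimitCycle (rayleighLienard n a) γ →
        (a < 0 → IsStableCycle (rayleighLienard n a) γ) ∧
        (0 < a → IsUnstableCycle (rayleighLienard n a) γ)) ∧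
      (a = 0 → IsLinearCenter (rayleighLienard n a))) := by
  -- The stable Liénard case is the only dynamical input; the other three sign cases are conjugate
  -- to it, two of them after time reversal.
  have hL : ∀ c < 0, ∃ γ, IsPeriodicOrbit (rayleighLienard n c) γ ∧
      (∀ γ', IsPeriodicOrbit (rayleighLienard n c) γ' → γ' = γ) ∧
      IsStableCycle (rayleighLienard n c) γ := fun c hc => by
    simpa using exists_unique_stable_periodicOrbit hn (neg_pos.2 hc)
  have hRpos : 0 < a → _ := fun ha => existsUnique_isLimitCycle
    (exists_unique_stable_of_conj (rayleigh_conj n a) (hL (-a) (neg_neg_of_pos ha)))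
  have hRneg : a < 0 → _ := fun ha => existsUnique_isLimitCycle
    (exists_unique_unstable_of_reversed
      (exists_unique_stable_of_conj (rayleigh_reversed_conj n a) (hL a ha)))
  have hLneg : a < 0 → _ := fun ha => existsUnique_isLimitCycle (hL a ha)
  have hLpos : 0 < a → _ := fun ha => existsUnique_isLimitCycle
    (exists_unique_unstable_of_reversed
      (exists_unique_stable_of_conj (rayleighLienard_reversed_conj n a)
        (hL (-a) (neg_neg_of_pos ha))))
  refine ⟨⟨fun ha => ?_, fun γ hγ => ⟨fun ha => (hRpos ha).2 γ hγ, fun ha => (hRneg ha).2 γ hγ⟩, ?_⟩,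
    fun ha => ?_, fun γ hγ => ⟨fun ha => (hLneg ha).2 γ hγ, fun ha => (hLpos ha).2 γ hγ⟩, ?_⟩
  · rcases ha.lt_or_gt with h | h
    · exact (hRneg h).1
    · exact (hRpos h).1
  · rintro rfl
    convert isLinearCenter_rotation using 2 with z
    simp [rayleigh]
  · rcases ha.lt_or_gt with h | h
    · exact (hLneg h).1
    · exact (hLpos h).1
  · rintro rfl
    convert isLinearCenter_rotation using 2 with z
    simp [rayleighLienard]
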